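/- **Conventions.** A groupoid is written with source $s$, range $r$ and unit space $\mathcal G^{(0)}$. For a locally compact Hausdorff étale groupoid $\mathcal G$ and a continuous $\mathbb T$-valued 2-cocycle $\omega$ on $\mathcal G$ (that is, $\omega(\gamma,\eta\zeta)\,\omega(\eta,\zeta)=\omega(\gamma\eta,\zeta)\,\omega(\gamma,\eta)$ for composable $\gamma,\eta,\zeta$), let $C^*(\mathcal G,\omega)$ denote the reduced twisted groupoid $C^*$-algebra: the completion of $C_c(\mathcal G)$, with product $(\varphi*\psi)(\gamma)=\sum_{\eta\zeta=\gamma}\varphi(\eta)\psi(\zeta)\,\omega(\eta,\zeta)$, in the norm $\sup_{u\in\mathcal G^{(0)}}\|\pi_u(\varphi)\|$, where $\pi_u(\varphi)\xi=\varphi*\xi$ on $\ell^2(s^{-1}(u))$. A discrete group is regarded as a groupoid with one unit; $\delta_g\in C^*(G,\omega)$ is the point mass at $g\in G$. A subalgebra $B$ of a $C^*$-algebra $A$ is *Cartan* if it is maximal Abelian in $A$, there is a faithful conditional expectation $A\to B$, the normalizers $N(A,B)=\{n\in A: n^*bn,\ nbn^*\in B \text{ for all } b\in B\}$ generate $A$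 as a $C^*$-algebra, and $B$ contains a countable approximate unit for $A$. A *topological grading* of $A$ by a discrete Abelian group $\Gamma$ is a family of linearly independent closed subspaces $(A_t)_{t\in\Gamma}$ with dense span, $A_sA_t\subseteq A_{s+t}$, $A_t^*=A_{-t}$, and a faithful conditional expectation $A\to A_0$. An Abelian $C^*$-subalgebra $D\subseteq A_0$ is *$\Gamma$-Cartan* in $A$ (with respect to this grading) if $D$ is Cartan in $A_0$ and $N(A,D)$ spans a dense subspace of $A$. **Theorem.** Let $H$ and $K$ be discrete Abelian groups, let $\beta:K\to\operatorname{Aut}(H)$ be an action, let $G=H\rtimes_\beta K$, and let $\omega$ be a $\mathbb T$-valued 2-cocycle on $G$ with $\omega((h,0),(h',0))=1$ for all $h,h'\in H$. Let $\widehat H$ be the (compact) dual group of $H$. 1. There is an injective $*$-homomorphism $C(\widehat H)\to C^*(G,\omega)$ that sends the function $x\mapsto x(h)$ to $\delta_{(h,0)}$ for every $h\in H$. Its image, written $C(\widehat H)$, is $K$-Cartan in $C^*(G,\omega)$ with respect to the grading $A_k=\overline{\operatorname{span}}\{\delta_{(h,k)}:h\in H\}$, $k\in K$. 2. The formula $$(k.x)(h)=\overline{\omega((0,-k),(0,k))}\;\omega((0,-k),(h,0))\;\omega((\beta_{-k}(h),-k),(0,k))\;x(\beta_{-k}(h))$$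 defines an action of $K$ on $\widehat H$ by homeomorphisms. Let $K\rtimes\widehat H$ be its action groupoid, which is the space $K\times\widehat H$ with $s(k,x)=x$, $r(k,x)=k.x$ and $(k,l.x)(l,x)=(k+l,x)$, and let $\omega|_K$ be the 2-cocycle $((k,l.x),(l,x))\mapsto\omega((0,k),(0,l))$ on it. Then $C^*(G,\omega)$ and $C^*(K\rtimes\widehat H,\omega|_K)$ are isomorphic $C^*$-algebras. -/

import Mathlib

open scoped ContinuousMap CompactlySupported

/-! ### Cartan subalgebras and `Γ`-Cartan pairs -/

/-- `E` is a faithful conditional expectation from the C*-algebra `A` onto its subalgebra `B`: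
a contractive, positive, faithful, `B`-bimodular linear projection of `A` onto `B`. -/
structure IsFaithfulCondExp {A : Type*} [NonUnitalCStarAlgebra A]
    (B : NonUnitalStarSubalgebra ℂ A) (E : A →ₗ[ℂ] B) : Prop where
  apply_coe : ∀ b : B, E (b : A) = b
  norm_le : ∀ a : A, ‖E a‖ ≤ ‖a‖
  map_mul_left : ∀ (b : B) (a : A), E ((b : A) * a) = b * E a
  map_mul_right : ∀ (a : A) (b : B), E (a * (b : A)) = E a * b
  positive : ∀ a : A, ∃ b : B, E (star a * a) = star b * b
  faithful : ∀ a : A, E (star a * a) = 0 → a = 0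

/-- The set `N(A, D)` of normalizers of `D` in `A`. -/
def cstarNormalizers {A : Type*} [NonUnitalCStarAlgebra A]
    (D : NonUnitalStarSubalgebra ℂ A) : Set A :=
  {n | ∀ b ∈ D, star n * b * n ∈ D ∧ n * b * star n ∈ D}

/-- `D` is a Cartan subalgebra of the C*-algebra `A`. -/
structure IsCartanSubalgebra {A : Type*} [NonUnitalCStarAlgebra A]
    (D : NonUnitalStarSubalgebra ℂ A) : Prop where
  isClosed : IsClosed (D : Set A)
  /-- `D` is maximal among the Abelian *-subalgebras of `A`. -/
  maximal : Maximal (fun D' : NonUnitalStarSubalgebra ℂ A => ∀ a ∈ D', ∀ b ∈ D', a * b = b * a) D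
  exists_condExp : ∃ E : A →ₗ[ℂ] D, IsFaithfulCondExp D E
  /-- The normalizers generate `A` as a C*-algebra. -/
  generated : Dense (NonUnitalStarAlgebra.adjoin ℂ (cstarNormalizers D) : Set A)
  /-- `D` contains a countable approximate unit for `A`, of positive contractions. -/
  approxUnit : ∃ u : ℕ → A,
    (∀ n, ∃ b ∈ D, u n = star b * b) ∧ (∀ n, ‖u n‖ ≤ 1) ∧
    ∀ a : A, Filter.Tendsto (fun n => u n * a) Filter.atTop (nhds a) ∧
      Filter.Tendsto (fun n => a * u n) Filter.atTop (nhds a)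

/-- The algebraic part of a topological grading of `A` by the (multiplicatively written) Abelian
group `Γ`: linearly independent closed subspaces, with dense span, compatible with product and
adjoint. -/
structure IsStarGrading {Γ A : Type*} [CommGroup Γ] [NonUnitalCStarAlgebra A]
    (𝒜 : Γ → Submodule ℂ A) : Prop where
  isClosed : ∀ t, IsClosed (𝒜 t : Set A)
  independent : iSupIndep 𝒜
  mul_mem : ∀ s t : Γ, ∀ a ∈ 𝒜 s, ∀ b ∈ 𝒜 t, a * b ∈ 𝒜 (s * t)
  star_mem_iff : ∀ (t : Γ) (a : A), star a ∈ 𝒜 t ↔ a ∈ 𝒜 t⁻¹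
  dense : Dense ((⨆ t, 𝒜 t : Submodule ℂ A) : Set A)

/-- The component of the grading at the neutral element, as a *-subalgebra. -/
def IsStarGrading.neutral {Γ A : Type*} [CommGroup Γ] [NonUnitalCStarAlgebra A]
    {𝒜 : Γ → Submodule ℂ A} (h : IsStarGrading 𝒜) : NonUnitalStarSubalgebra ℂ A where
  carrier := 𝒜 1
  add_mem' := (𝒜 1).add_mem
  zero_mem' := (𝒜 1).zero_mem
  smul_mem' := fun c _ hx => (𝒜 1).smul_mem c hx
  mul_mem' := fun {a b} ha hb => by simpa using h.mul_mem 1 1 a ha b hb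
  star_mem' := fun {a} ha => (h.star_mem_iff 1 a).2 (by simpa using ha)

/-- `𝒜` is a topological grading of `A` by `Γ`. -/
structure IsTopologicalGrading {Γ A : Type*} [CommGroup Γ] [NonUnitalCStarAlgebra A]
    (𝒜 : Γ → Submodule ℂ A) : Prop extends IsStarGrading 𝒜 where
  exists_condExp : ∃ E : A →ₗ[ℂ] toIsStarGrading.neutral,
    IsFaithfulCondExp toIsStarGrading.neutral E

/-- `(A, D)` is `Γ`-Cartan for the grading `𝒜` of `A` by `Γ`: the grading is topological, `D` is an
Abelian C*-subalgebra of `A_0` that is Cartan in `A_0`, and the normalizers of `D` in `A` span a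
dense subspace of `A`. -/
structure IsGammaCartan {Γ A : Type*} [CommGroup Γ] [NonUnitalCStarAlgebra A]
    (𝒜 : Γ → Submodule ℂ A) (D : NonUnitalStarSubalgebra ℂ A) : Prop where
  grading : IsTopologicalGrading 𝒜
  isClosed : IsClosed (D : Set A)
  commutative : ∀ a ∈ D, ∀ b ∈ D, a * b = b * a
  le_neutral : D ≤ grading.toIsStarGrading.neutral
  cartan :
    haveI : IsClosed (grading.toIsStarGrading.neutral : Set A) := grading.isClosed 1
    IsCartanSubalgebra
      (D.comap (NonUnitalStarSubalgebraClass.subtype grading.toIsStarGrading.neutral))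
  dense_span : Dense (Submodule.span ℂ (cstarNormalizers D) : Set A)

/-! ### Étale groupoids, 2-cocycles and reduced twisted groupoid C*-algebras -/

/-- A locally compact Hausdorff étale groupoid with space of arrows `𝒢`. The product `mul γ η` is
meaningful only if `src γ = rng η`; its other values are never used. Units are identified with
their identity arrows. -/
structure EtaleGroupoid (𝒢 : Type*) [TopologicalSpace 𝒢] where
  src : 𝒢 → 𝒢
  rng : 𝒢 → 𝒢
  inv : 𝒢 → 𝒢
  mul : 𝒢 → 𝒢 → 𝒢
  src_mul : ∀ γ η, src γ = rng η → src (mul γ η) = src η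
  rng_mul : ∀ γ η, src γ = rng η → rng (mul γ η) = rng γ
  mul_assoc : ∀ γ η ζ, src γ = rng η → src η = rng ζ → mul (mul γ η) ζ = mul γ (mul η ζ)
  rng_src : ∀ γ, rng (src γ) = src γ
  src_rng : ∀ γ, src (rng γ) = rng γ
  mul_src : ∀ γ, mul γ (src γ) = γ
  rng_mul_self : ∀ γ, mul (rng γ) γ = γ
  src_inv : ∀ γ, src (inv γ) = rng γ
  rng_inv : ∀ γ, rng (inv γ) = src γ
  inv_mul : ∀ γ, mul (inv γ) γ = src γ
  mul_inv : ∀ γ, mul γ (inv γ) = rng γ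
  t2Space : T2Space 𝒢
  locallyCompactSpace : LocallyCompactSpace 𝒢
  continuous_inv : Continuous inv
  continuousOn_mul : ContinuousOn (fun p : 𝒢 × 𝒢 => mul p.1 p.2) {p | src p.1 = rng p.2}
  isLocalHomeomorph_rng : IsLocalHomeomorph rng

/-- A continuous `𝕋`-valued 2-cocycle on an étale groupoid. Only its values on composable pairs
matter. -/
structure EtaleGroupoid.TwoCocycle {𝒢 : Type*} [TopologicalSpace 𝒢] (G : EtaleGroupoid 𝒢) where
  toFun : 𝒢 → 𝒢 → Circle
  continuousOn : ContinuousOn (fun p : 𝒢 × 𝒢 => toFun p.1 p.2) {p | G.src p.1 = G.rng p.2}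
  cocycle : ∀ γ η ζ, G.src γ = G.rng η → G.src η = G.rng ζ →
    toFun γ (G.mul η ζ) * toFun η ζ = toFun (G.mul γ η) ζ * toFun γ η

/-- The Hilbert space `ℓ²(𝒢)`. It is the Hilbert sum over all units `u` of the spaces `ℓ²(𝒢_u)`,
where `𝒢_u` is the set of arrows with source `u`. -/
noncomputable abbrev EllTwo (𝒢 : Type*) := lp (fun _ : 𝒢 => ℂ) 2

/-- `T` is the operator `ξ ↦ φ * ξ` on `ℓ²(𝒢)`, where
`(φ * ξ)(γ) = ∑_{η ζ = γ} φ(η) ξ(ζ) ω(η, ζ)`. As this operator preserves each `ℓ²(𝒢_u)`,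
it is the direct sum of the left regular representations `π_u(φ)` over all units `u`. -/
def EtaleGroupoid.IsLeftConvolution {𝒢 : Type*} [TopologicalSpace 𝒢] {G : EtaleGroupoid 𝒢}
    (ω : G.TwoCocycle) (φ : 𝒢 → ℂ) (T : EllTwo 𝒢 →L[ℂ] EllTwo 𝒢) : Prop :=
  ∀ (ξ : EllTwo 𝒢) (γ : 𝒢), T ξ γ =
    ∑ᶠ p ∈ {p : 𝒢 × 𝒢 | G.src p.1 = G.rng p.2 ∧ G.mul p.1 p.2 = γ},
      φ p.1 * ξ p.2 * (ω.toFun p.1 p.2 : ℂ)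

/-- The reduced twisted groupoid C*-algebra `C*_r(G, ω)`: the norm closure of the algebra of all
operators `ξ ↦ φ * ξ` with `φ ∈ C_c(𝒢)`. Its norm on `C_c(𝒢)` is `sup_u ‖π_u(φ)‖`. -/
noncomputable def EtaleGroupoid.reducedCStar {𝒢 : Type*} [TopologicalSpace 𝒢]
    {G : EtaleGroupoid 𝒢} (ω : G.TwoCocycle) :
    NonUnitalStarSubalgebra ℂ (EllTwo 𝒢 →L[ℂ] EllTwo 𝒢) :=
  (NonUnitalStarAlgebra.adjoin ℂ
    {T | ∃ φ : C_c(𝒢, ℂ), EtaleGroupoid.IsLeftConvolution ω φ T}).topologicalClosure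

instance EtaleGroupoid.isClosed_reducedCStar {𝒢 : Type*} [TopologicalSpace 𝒢]
    {G : EtaleGroupoid 𝒢} (ω : G.TwoCocycle) :
    IsClosed (EtaleGroupoid.reducedCStar ω : Set (EllTwo 𝒢 →L[ℂ] EllTwo 𝒢)) :=
  NonUnitalStarSubalgebra.isClosed_topologicalClosure _

/-- For a map `c : 𝒢 → Γ`, the closed subspace `A_t` of `C*_r(G, ω)` spanned by the functions
`φ ∈ C_c(𝒢)` that are supported in `c⁻¹(t)`. -/
noncomputable def EtaleGroupoid.gradedPart {𝒢 Γ : Type*} [TopologicalSpace 𝒢]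
    {G : EtaleGroupoid 𝒢} (ω : G.TwoCocycle) (c : 𝒢 → Γ) (t : Γ) :
    Submodule ℂ (EtaleGroupoid.reducedCStar ω) :=
  (Submodule.span ℂ {a : EtaleGroupoid.reducedCStar ω | ∃ φ : C_c(𝒢, ℂ),
    (∀ γ, φ γ ≠ 0 → c γ = t) ∧
      EtaleGroupoid.IsLeftConvolution ω φ (a : EllTwo 𝒢 →L[ℂ] EllTwo 𝒢)}).topologicalClosure

/-! ### Discrete groups and action groupoids -/

/-- A discrete group, as a groupoid with one unit. -/
def groupGroupoid (G : Type*) [Group G] [TopologicalSpace G] [DiscreteTopology G] :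
    EtaleGroupoid G where
  src _ := 1
  rng _ := 1
  inv g := g⁻¹
  mul g h := g * h
  src_mul _ _ _ := rfl
  rng_mul _ _ _ := rfl
  mul_assoc a b c _ _ := _root_.mul_assoc a b c
  rng_src _ := rfl
  src_rng _ := rfl
  mul_src := mul_one
  rng_mul_self := one_mul
  src_inv _ := rfl
  rng_inv _ := rfl
  inv_mul := inv_mul_cancel
  mul_inv := mul_inv_cancel
  t2Space := inferInstance
  locallyCompactSpace := inferInstance
  continuous_inv := continuous_of_discreteTopology
  continuousOn_mul := continuous_of_discreteTopology.continuousOn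
  isLocalHomeomorph_rng := by
    rw [isLocalHomeomorph_iff_isOpenEmbedding_restrict]
    intro x
    refine ⟨{x}, (isOpen_discrete _).mem_nhds rfl, ?_⟩
    refine Topology.IsOpenEmbedding.of_continuous_injective_isOpenMap
      continuous_of_discreteTopology ?_ (fun _ _ => isOpen_discrete _)
    intro a b _
    exact Subsingleton.elim a b

/-- The action groupoid `K ⋊ X` of an action `α` of a discrete group `K` on a locally compact
Hausdorff space `X` by homeomorphisms: `s(k, x) = x`, `r(k, x) = k.x`,
`(k, l.x)(l, x) = (kl, x)` and `(k, x)⁻¹ = (k⁻¹, k.x)`; the unit `x` is the arrow `(1, x)`. -/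
def actionGroupoid {K X : Type*} [Group K] [TopologicalSpace K] [DiscreteTopology K]
    [TopologicalSpace X] [T2Space X] [LocallyCompactSpace X] (α : K →* (X ≃ₜ X)) :
    EtaleGroupoid (K × X) where
  src γ := (1, γ.2)
  rng γ := (1, α γ.1 γ.2)
  inv γ := (γ.1⁻¹, α γ.1 γ.2)
  mul γ η := (γ.1 * η.1, η.2)
  src_mul _ _ _ := rfl
  rng_mul := by
    rintro ⟨k, x⟩ ⟨l, y⟩ h
    obtain rfl : x = α l y := by simpa using h
    simp
  mul_assoc a b c _ _ := by simp [_root_.mul_assoc]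
  rng_src _ := by simp
  src_rng _ := rfl
  mul_src _ := by simp
  rng_mul_self _ := by simp
  src_inv _ := rfl
  rng_inv := by
    rintro ⟨k, x⟩
    simp [← Homeomorph.mul_apply]
  inv_mul _ := by simp
  mul_inv _ := by simp
  t2Space := inferInstance
  locallyCompactSpace := inferInstance
  continuous_inv := by
    refine (continuous_of_discreteTopology.comp continuous_fst).prodMk ?_
    exact continuous_prod_of_discrete_left.2 fun k => (α k).continuous
  continuousOn_mul := by
    have h : Continuous fun p : K × K => p.1 * p.2 := continuous_of_discreteTopology
    exact Continuous.continuousOn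
      ((h.comp ((continuous_fst.comp continuous_fst).prodMk
        (continuous_fst.comp continuous_snd))).prodMk (continuous_snd.comp continuous_snd))
  isLocalHomeomorph_rng := by
    rw [isLocalHomeomorph_iff_isOpenEmbedding_restrict]
    rintro ⟨k, x⟩
    refine ⟨{k} ×ˢ Set.univ, ((isOpen_discrete _).prod isOpen_univ).mem_nhds (by simp), ?_⟩
    have hr : Continuous fun γ : K × X => ((1 : K), α γ.1 γ.2) :=
      continuous_const.prodMk (continuous_prod_of_discrete_left.2 fun k => (α k).continuous)
    refine Topology.IsOpenEmbedding.of_continuous_injective_isOpenMap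
      (hr.comp continuous_subtype_val) ?_ ?_
    · rintro ⟨⟨a, y⟩, ha⟩ ⟨⟨b, z⟩, hb⟩ h
      have ha' : a = k := ha.1
      have hb' : b = k := hb.1
      subst ha' hb'
      have h2 : α b y = α b z := congrArg Prod.snd h
      have h3 : y = z := (α b).injective h2
      subst h3
      rfl
    · intro U hU
      obtain ⟨V, hV, rfl⟩ := isOpen_induced_iff.1 hU
      have hW : IsOpen ({1} ×ˢ ((α k) '' {y | (k, y) ∈ V}) : Set (K × X)) :=
        (isOpen_discrete _).prod
          ((α k).isOpenMap _ (hV.preimage (continuous_const.prodMk continuous_id)))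
      convert hW using 1
      ext ⟨l, z⟩
      constructor
      · rintro ⟨⟨⟨a, y⟩, ha⟩, hy, h⟩
        have ha' : a = k := ha.1
        subst ha'
        exact ⟨(congrArg Prod.fst h).symm, y, hy, congrArg Prod.snd h⟩
      · rintro ⟨hl, y, hy, hz⟩
        exact ⟨⟨(k, y), ⟨rfl, trivial⟩⟩, hy, Prod.ext (Eq.symm hl) hz⟩

/-! ### The semidirect product `H ⋊ K` and the action of `K` on the dual of `H` -/

/-- The topology of `H × K` on the semidirect product `H ⋊ K`. -/
instance SemidirectProduct.instTopologicalSpaceOfProd {H K : Type*} [Group H] [Group K]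
    [TopologicalSpace H] [TopologicalSpace K] (β : K →* MulAut H) :
    TopologicalSpace (H ⋊[β] K) :=
  TopologicalSpace.induced (SemidirectProduct.equivProd (φ := β)) inferInstance

instance SemidirectProduct.instDiscreteTopologyOfProd {H K : Type*} [Group H] [Group K]
    [TopologicalSpace H] [TopologicalSpace K] [DiscreteTopology H] [DiscreteTopology K]
    (β : K →* MulAut H) : DiscreteTopology (H ⋊[β] K) :=
  DiscreteTopology.of_continuous_injective
    (continuous_induced_dom (f := SemidirectProduct.equivProd (φ := β)))
    (SemidirectProduct.equivProd (φ := β)).injective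

theorem addCocycle_conj {G M : Type*} [Group G] [AddCommGroup M] (u : G → G → M)
    (hu : ∀ a b c, u a (b * c) + u b c = u (a * b) c + u a b) (h1 : u 1 1 = 0) (k h : G) :
    -u k⁻¹ k + u k⁻¹ h + u (k⁻¹ * h) k = u h k - u k (k⁻¹ * h * k) := by
  have hl : ∀ g, u 1 g = 0 := fun g => by
    have := hu 1 1 g
    simp only [one_mul, h1, add_zero] at this
    simpa using this
  have hr : ∀ g, u g 1 = 0 := fun g => by
    have := hu g 1 1
    simp only [mul_one, h1, add_zero] at this
    simpa using this
  have e1 := hu k (k⁻¹ * h) k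
  have e2 := hu k k⁻¹ h
  have e3 := hu k k⁻¹ k
  simp only [mul_inv_cancel_left, mul_inv_cancel, inv_mul_cancel, hl, hr] at e1 e2 e3
  grind

theorem addCocycle_conj_mul {G M : Type*} [Group G] [AddCommGroup M] (u : G → G → M)
    (hu : ∀ a b c, u a (b * c) + u b c = u (a * b) c + u a b) (k a b : G) :
    (u a k - u k (k⁻¹ * a * k)) + (u b k - u k (k⁻¹ * b * k)) +
        u (k⁻¹ * a * k) (k⁻¹ * b * k) =
      u a b + (u (a * b) k - u k (k⁻¹ * (a * b) * k)) := by
  have e1 := hu a b k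
  have e2 := hu a k (k⁻¹ * b * k)
  have e3 := hu k (k⁻¹ * a * k) (k⁻¹ * b * k)
  have f1 : k * (k⁻¹ * b * k) = b * k := by group
  have f2 : k * (k⁻¹ * a * k) = a * k := by group
  have f3 : k⁻¹ * a * k * (k⁻¹ * b * k) = k⁻¹ * (a * b) * k := by group
  rw [f1] at e2
  rw [f2, f3] at e3
  grind

theorem addCocycle_conj_conj {G M : Type*} [Group G] [AddCommGroup M] (u : G → G → M)
    (hu : ∀ a b c, u a (b * c) + u b c = u (a * b) c + u a b) (k l h : G) :
    u h (k * l) - u (k * l) ((k * l)⁻¹ * h * (k * l)) =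
      (u h k - u k (k⁻¹ * h * k)) +
        (u (k⁻¹ * h * k) l - u l (l⁻¹ * (k⁻¹ * h * k) * l)) := by
  have e1 := hu h k l
  have e2 := hu k (k⁻¹ * h * k) l
  have e3 := hu k l (l⁻¹ * (k⁻¹ * h * k) * l)
  have f1 : k * (k⁻¹ * h * k) = h * k := by group
  have f2 : l * (l⁻¹ * (k⁻¹ * h * k) * l) = k⁻¹ * h * k * l := by group
  have f3 : (k * l)⁻¹ * h * (k * l) = l⁻¹ * (k⁻¹ * h * k) * l := by group
  rw [f1] at e2
  rw [f2] at e3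
  rw [f3]
  grind

open SemidirectProduct in
theorem inr_conj_inl {H K : Type*} [Group H] [Group K] {β : K →* MulAut H} (k : K) (h : H) :
    (inr k : H ⋊[β] K)⁻¹ * inl h * inr k = inl (β k⁻¹ h) := by
  ext <;> simp

section DualAction

variable {H K : Type*} [CommGroup H] [CommGroup K] [TopologicalSpace H] [TopologicalSpace K]
  [DiscreteTopology H] [DiscreteTopology K] {β : K →* MulAut H}

open SemidirectProduct in
/-- The scalar
`conj(ω((1, k⁻¹), (1, k))) ω((1, k⁻¹), (h, 1)) ω((β_{k⁻¹}(h), k⁻¹), (1, k))`. -/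
noncomputable def conjFactor (ω : (groupGroupoid (H ⋊[β] K)).TwoCocycle) (k : K) (h : H) :
    Circle :=
  (ω.toFun (inr k⁻¹) (inr k))⁻¹ * ω.toFun (inr k⁻¹) (inl h) *
    ω.toFun ⟨β k⁻¹ h, k⁻¹⟩ (inr k)

open SemidirectProduct in
theorem ofMul_conjFactor (ω : (groupGroupoid (H ⋊[β] K)).TwoCocycle)
    (hω : ∀ h h' : H, ω.toFun (inl h) (inl h') = 1) (k : K) (h : H) :
    Additive.ofMul (conjFactor ω k h) =
      Additive.ofMul (ω.toFun (inl h) (inr k)) -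
        Additive.ofMul (ω.toFun (inr k) ((inr k)⁻¹ * inl h * inr k)) := by
  have := addCocycle_conj (fun a b => Additive.ofMul (ω.toFun a b))
    (fun a b c => congrArg Additive.ofMul (ω.cocycle a b c rfl rfl))
    (by simpa using hω 1 1) (inr k) (inl h)
  rw [← this]
  have e : (inr k : H ⋊[β] K)⁻¹ * inl h = ⟨β k⁻¹ h, k⁻¹⟩ := by ext <;> simp
  rw [e]
  simp [conjFactor, ofMul_mul]

theorem conjFactor_mul (ω : (groupGroupoid (H ⋊[β] K)).TwoCocycle)
    (hω : ∀ h h' : H, ω.toFun (SemidirectProduct.inl h) (SemidirectProduct.inl h') = 1)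
    (k : K) (a b : H) : conjFactor ω k (a * b) = conjFactor ω k a * conjFactor ω k b := by
  have := addCocycle_conj_mul (fun a b => Additive.ofMul (ω.toFun a b))
    (fun a b c => congrArg Additive.ofMul (ω.cocycle a b c rfl rfl))
    (SemidirectProduct.inr k) (SemidirectProduct.inl a) (SemidirectProduct.inl b)
  simp only [← map_mul] at this
  rw [← ofMul_conjFactor ω hω, ← ofMul_conjFactor ω hω, ← ofMul_conjFactor ω hω] at this
  simp only [inr_conj_inl, hω, ofMul_one, add_zero, zero_add] at this
  exact this.symm

theorem conjFactor_conjFactor (ω : (groupGroupoid (H ⋊[β] K)).TwoCocycle)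
    (hω : ∀ h h' : H, ω.toFun (SemidirectProduct.inl h) (SemidirectProduct.inl h') = 1)
    (k l : K) (h : H) :
    conjFactor ω (k * l) h = conjFactor ω k h * conjFactor ω l (β k⁻¹ h) := by
  have := addCocycle_conj_conj (fun a b => Additive.ofMul (ω.toFun a b))
    (fun a b c => congrArg Additive.ofMul (ω.cocycle a b c rfl rfl))
    (SemidirectProduct.inr k) (SemidirectProduct.inr l) (SemidirectProduct.inl h)
  simp only [← map_mul] at this
  rw [← ofMul_conjFactor ω hω, ← ofMul_conjFactor ω hω, inr_conj_inl,
    ← ofMul_conjFactor ω hω] at this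
  exact this

/-- The character `k.x` of `H`, for `k ∈ K` and `x` in the dual of `H`:
`(k.x)(h) = conj(ω((1, k⁻¹), (1, k))) ω((1, k⁻¹), (h, 1)) ω((β_{k⁻¹}(h), k⁻¹), (1, k))
x(β_{k⁻¹}(h))`. -/
noncomputable def dualActionFun (ω : (groupGroupoid (H ⋊[β] K)).TwoCocycle)
    (hω : ∀ h h' : H, ω.toFun (SemidirectProduct.inl h) (SemidirectProduct.inl h') = 1)
    (k : K) (x : PontryaginDual H) : PontryaginDual H :=
  show H →ₜ* Circle from
  { toFun := fun h => conjFactor ω k h * x (β k⁻¹ h)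
    map_one' := by
      have := conjFactor_mul ω hω k 1 1
      simp only [mul_one, left_eq_mul] at this
      rw [this, map_one, map_one, one_mul]
    map_mul' := fun a b => by
      rw [conjFactor_mul ω hω, map_mul, map_mul, mul_mul_mul_comm]
    continuous_toFun := continuous_of_discreteTopology }

theorem dualActionFun_apply (ω : (groupGroupoid (H ⋊[β] K)).TwoCocycle)
    (hω : ∀ h h' : H, ω.toFun (SemidirectProduct.inl h) (SemidirectProduct.inl h') = 1)
    (k : K) (x : PontryaginDual H) (h : H) :
    dualActionFun ω hω k x h = conjFactor ω k h * x (β k⁻¹ h) := rfl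

theorem dualActionFun_mul (ω : (groupGroupoid (H ⋊[β] K)).TwoCocycle)
    (hω : ∀ h h' : H, ω.toFun (SemidirectProduct.inl h) (SemidirectProduct.inl h') = 1)
    (k l : K) (x : PontryaginDual H) :
    dualActionFun ω hω (k * l) x = dualActionFun ω hω k (dualActionFun ω hω l x) := by
  ext1 h
  simp only [dualActionFun_apply]
  rw [conjFactor_conjFactor ω hω k l h, mul_assoc]
  have : β (k * l)⁻¹ h = β l⁻¹ (β k⁻¹ h) := by
    rw [mul_inv_rev, map_mul, MulAut.mul_apply]
  rw [this]

theorem dualActionFun_one (ω : (groupGroupoid (H ⋊[β] K)).TwoCocycle)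
    (hω : ∀ h h' : H, ω.toFun (SemidirectProduct.inl h) (SemidirectProduct.inl h') = 1)
    (x : PontryaginDual H) : dualActionFun ω hω 1 x = x := by
  ext1 h
  have := conjFactor_conjFactor ω hω 1 1 h
  simp only [mul_one, inv_one, map_one, MulAut.one_apply, left_eq_mul] at this
  rw [dualActionFun_apply, this]
  simp

theorem continuous_dualActionFun (ω : (groupGroupoid (H ⋊[β] K)).TwoCocycle)
    (hω : ∀ h h' : H, ω.toFun (SemidirectProduct.inl h) (SemidirectProduct.inl h') = 1)
    (k : K) : Continuous (dualActionFun ω hω k) := by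
  have hind : Topology.IsInducing fun (x : PontryaginDual H) (h : H) => x h :=
    (ContinuousMap.isHomeomorph_coe (X := H) (Y := Circle)).isInducing.comp
      (ContinuousMonoidHom.isInducing_toContinuousMap H Circle)
  rw [hind.continuous_iff]
  refine continuous_pi fun h => ?_
  exact continuous_const.mul ((continuous_apply (β k⁻¹ h)).comp hind.continuous)

/-- The action of `K` on the dual of `H` by homeomorphisms, `x ↦ k.x`. -/
noncomputable def dualAction (ω : (groupGroupoid (H ⋊[β] K)).TwoCocycle)
    (hω : ∀ h h' : H, ω.toFun (SemidirectProduct.inl h) (SemidirectProduct.inl h') = 1) :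
    K →* (PontryaginDual H ≃ₜ PontryaginDual H) where
  toFun k :=
    { toFun := dualActionFun ω hω k
      invFun := dualActionFun ω hω k⁻¹
      left_inv := fun x => by
        rw [← dualActionFun_mul, inv_mul_cancel, dualActionFun_one]
      right_inv := fun x => by
        rw [← dualActionFun_mul, mul_inv_cancel, dualActionFun_one]
      continuous_toFun := continuous_dualActionFun ω hω k
      continuous_invFun := continuous_dualActionFun ω hω k⁻¹ }
  map_one' := Homeomorph.ext fun x => dualActionFun_one ω hω x
  map_mul' k l := Homeomorph.ext fun x => dualActionFun_mul ω hω k l x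

/-- The 2-cocycle `((k, l.x), (l, x)) ↦ ω((1, k), (1, l))` that the restriction of `ω` to `K`
induces on an action groupoid `K ⋊ X`. -/
def restrictCocycle (ω : (groupGroupoid (H ⋊[β] K)).TwoCocycle) {X : Type*} [TopologicalSpace X]
    [T2Space X] [LocallyCompactSpace X] (α : K →* (X ≃ₜ X)) :
    (actionGroupoid α).TwoCocycle where
  toFun γ η := ω.toFun (SemidirectProduct.inr γ.1) (SemidirectProduct.inr η.1)
  continuousOn := by
    have h : Continuous fun p : K × K =>
        ω.toFun (SemidirectProduct.inr p.1) (SemidirectProduct.inr p.2) :=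
      continuous_of_discreteTopology
    exact (h.comp ((continuous_fst.comp continuous_fst).prodMk
      (continuous_fst.comp continuous_snd))).continuousOn
  cocycle γ η ζ _ _ := by
    have := ω.cocycle (SemidirectProduct.inr γ.1) (SemidirectProduct.inr η.1)
      (SemidirectProduct.inr ζ.1) rfl rfl
    simpa [groupGroupoid, actionGroupoid] using this

/-- The evaluation function `x ↦ x(h)` on the dual of `H`. -/
noncomputable def evalDual (h : H) : C(PontryaginDual H, ℂ) where
  toFun x := (x h : ℂ)
  continuous_toFun := by
    have hind : Topology.IsInducing fun (x : PontryaginDual H) (h : H) => x h :=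
      (ContinuousMap.isHomeomorph_coe (X := H) (Y := Circle)).isInducing.comp
        (ContinuousMonoidHom.isInducing_toContinuousMap H Circle)
    exact (show Continuous ((↑) : Circle → ℂ) by fun_prop).comp ((continuous_apply h).comp hind.continuous)

end DualAction

/-!
Both algebras carry a copy of the same system of unitaries. In `C*(G, ω)` these are the point
masses `δ_g`. In the C*-algebra of the action groupoid, the unitary for `g = (1, k) (h, 1)` is, up
to the scalar `ω((1, k), (h, 1))`, the indicator function of the slice `{k} × Ĥ` times the function
`x ↦ x(h)` on the unit space. The definition of the action of `K` on `Ĥ` is what makes these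
unitaries multiply with the cocycle `ω` as well (`unitaryWeight_mul`), and their span is dense by
the Stone-Weierstrass theorem (`dense_span_canonicalUnitary`).

Two such twisted representations of `G` generate isomorphic C*-algebras as soon as there are
faithful functionals on these algebras that agree on the generators
(`IsTwistedRep.exists_starAlgEquiv`): on the C*-algebra that the pairs of generators span in the
product of the two algebras, the functionals agree, so that an element of it with one coordinate
equal to zero is zero. No comparison of norms is needed, because injective *-homomorphisms are
isometric. On `C*(G, ω)` the functional is the trace `T ↦ ⟨δ_1, T δ_1⟩`. On the groupoid side it is
the Haar integral over `Ĥ` of the conditional expectation `dualExp` onto `C(Ĥ)`. Both are faithful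
because all diagonal coefficients of an operator can be read off from those at the units
(`diagCoeff_eq_groupTrace`, `diagCoeff_eq_dualExp`). They agree on the generators because a
nontrivial character of `Ĥ` has integral zero (`exists_haarFunctional`).

The inclusion of `C(Ĥ)` and the conditional expectation are obvious on the groupoid side and are
transported to `C*(G, ω)`. There the image of `C(Ĥ)` is the whole neutral component of the grading,
so it is Cartan in this component for trivial reasons, and the point masses normalize it since `K`
is commutative (`IsTwistedRep.isGammaCartan_range`).
-/

/-! ### Twisted representations of a group -/

/-- A family `v` of elements of a C*-algebra that is indexed by a group `G` and multiplies like the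
point masses of the group algebra twisted by the normalized cocycle `w`. The formula for the adjoint
expresses that `v g` is a unitary of the algebra with unit `v 1`. -/
structure IsTwistedRep {G A : Type*} [Group G] [NonUnitalCStarAlgebra A] (w : G → G → Circle)
    (v : G → A) : Prop where
  mul_eq : ∀ g h, v g * v h = (w g h : ℂ) • v (g * h)
  star_eq : ∀ g, star (v g) = (((w g⁻¹ g)⁻¹ : Circle) : ℂ) • v g⁻¹

/-- An injective *-homomorphism is isometric, so its range is closed. -/
theorem NonUnitalStarAlgHom.surjective_of_span_dense {I A B : Type*} [NonUnitalCStarAlgebra A]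
    [NonUnitalCStarAlgebra B] {v : I → A} (π : B →⋆ₙₐ[ℂ] A)
    (hπ : Function.Injective π) (hd : Dense (Submodule.span ℂ (Set.range v) : Set A))
    (hv : ∀ g, v g ∈ Set.range π) : Function.Surjective π := by
  have hc : IsClosed (Set.range π) :=
    (NonUnitalStarAlgHom.isometry π hπ).isClosedEmbedding.isClosed_range
  have hle : (Submodule.span ℂ (Set.range v) : Set A) ⊆ Set.range π := by
    have : Submodule.span ℂ (Set.range v) ≤ LinearMap.range (π : B →ₗ[ℂ] A) :=
      Submodule.span_le.2 (by rintro _ ⟨g, rfl⟩; exact hv g)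
    exact this
  rw [← Set.range_eq_univ, ← hc.closure_eq]
  exact (hd.mono hle).closure_eq

section TwistedRep

variable {G A B : Type*} [Group G] [NonUnitalCStarAlgebra A] [NonUnitalCStarAlgebra B]
  {w : G → G → Circle} {v : G → A} {u : G → B}

theorem IsTwistedRep.prod (hv : IsTwistedRep w v) (hu : IsTwistedRep w u) :
    IsTwistedRep w fun g => (v g, u g) where
  mul_eq g h := Prod.ext (hv.mul_eq g h) (hu.mul_eq g h)
  star_eq g := Prod.ext (hv.star_eq g) (hu.star_eq g)

/-- The linear span of a twisted representation, as a *-subalgebra. -/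
def IsTwistedRep.span (hv : IsTwistedRep w v) : NonUnitalStarSubalgebra ℂ A where
  carrier := Submodule.span ℂ (Set.range v)
  add_mem' := (Submodule.span ℂ (Set.range v)).add_mem
  zero_mem' := (Submodule.span ℂ (Set.range v)).zero_mem
  smul_mem' c _ hx := (Submodule.span ℂ (Set.range v)).smul_mem c hx
  mul_mem' {a b} ha hb := by
    have key : ∀ a ∈ Submodule.span ℂ (Set.range v), ∀ b ∈ Submodule.span ℂ (Set.range v),
        a * b ∈ Submodule.span ℂ (Set.range v) := by
      intro a ha b hb
      induction ha, hb using Submodule.span_induction₂ with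
      | mem_mem x y hx hy =>
        obtain ⟨g, rfl⟩ := hx
        obtain ⟨h, rfl⟩ := hy
        rw [hv.mul_eq]
        exact Submodule.smul_mem _ _ (Submodule.subset_span ⟨_, rfl⟩)
      | zero_left y hy => simp
      | zero_right x hx => simp
      | add_left x y z _ _ _ h₁ h₂ => rw [add_mul]; exact add_mem h₁ h₂
      | add_right x y z _ _ _ h₁ h₂ => rw [mul_add]; exact add_mem h₁ h₂
      | smul_left r x y _ _ h => rw [smul_mul_assoc]; exact Submodule.smul_mem _ _ h
      | smul_right r x y _ _ h => rw [mul_smul_comm]; exact Submodule.smul_mem _ _ h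
    exact key a ha b hb
  star_mem' {a} ha := by
    have key : ∀ a ∈ Submodule.span ℂ (Set.range v), star a ∈ Submodule.span ℂ (Set.range v) := by
      intro a ha
      induction ha using Submodule.span_induction with
      | mem x hx =>
        obtain ⟨g, rfl⟩ := hx
        rw [hv.star_eq]
        exact Submodule.smul_mem _ _ (Submodule.subset_span ⟨_, rfl⟩)
      | zero => simp
      | add x y _ _ h₁ h₂ => rw [star_add]; exact add_mem h₁ h₂
      | smul r x _ h => rw [star_smul]; exact Submodule.smul_mem _ _ h
    exact key a ha

theorem IsTwistedRep.mem_span (hv : IsTwistedRep w v) (g : G) : v g ∈ hv.span :=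
  Submodule.subset_span ⟨g, rfl⟩

/-- Two twisted representations with the same cocycle generate isomorphic C*-algebras as soon as
faithful functionals on these algebras take the same values on them. In the product of the two
algebras, the functionals agree on all pairs in the closed span of the pairs `(v g, u g)`, so by
faithfulness both coordinate projections of this C*-algebra are injective. -/
theorem IsTwistedRep.exists_starAlgEquiv (hv : IsTwistedRep w v) (hu : IsTwistedRep w u)
    (hvd : Dense (Submodule.span ℂ (Set.range v) : Set A))
    (hud : Dense (Submodule.span ℂ (Set.range u) : Set B)) (τ : A →L[ℂ] ℂ) (σ : B →L[ℂ] ℂ)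
    (hτσ : ∀ g, τ (v g) = σ (u g)) (hτ : ∀ a, τ (star a * a) = 0 → a = 0)
    (hσ : ∀ b, σ (star b * b) = 0 → b = 0) : ∃ Φ : A ≃⋆ₐ[ℂ] B, ∀ g, Φ (v g) = u g := by
  set S : NonUnitalStarSubalgebra ℂ (A × B) := (hv.prod hu).span.topologicalClosure with hS
  have : IsClosed (S : Set (A × B)) := NonUnitalStarSubalgebra.isClosed_topologicalClosure _
  have hmem (g : G) : (v g, u g) ∈ S :=
    NonUnitalStarSubalgebra.le_topologicalClosure _ ((hv.prod hu).mem_span g)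
  have hagree : ∀ p ∈ S, τ p.1 = σ p.2 := by
    have hcl : IsClosed {p : A × B | τ p.1 = σ p.2} :=
      isClosed_eq (by fun_prop) (by fun_prop)
    have hsub : ((hv.prod hu).span : Set (A × B)) ⊆ {p : A × B | τ p.1 = σ p.2} := by
      have : Submodule.span ℂ (Set.range fun g => (v g, u g)) ≤
          LinearMap.eqLocus (τ.toLinearMap ∘ₗ LinearMap.fst ℂ A B)
            (σ.toLinearMap ∘ₗ LinearMap.snd ℂ A B) :=
        Submodule.span_le.2 (by rintro _ ⟨g, rfl⟩; exact hτσ g)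
      exact this
    exact fun p hp => closure_minimal hsub hcl hp
  let π₁ : S →⋆ₙₐ[ℂ] A :=
    (NonUnitalStarAlgHom.fst ℂ A B).comp (NonUnitalStarSubalgebraClass.subtype S)
  let π₂ : S →⋆ₙₐ[ℂ] B :=
    (NonUnitalStarAlgHom.snd ℂ A B).comp (NonUnitalStarSubalgebraClass.subtype S)
  have h₁ : Function.Injective π₁ := by
    refine (injective_iff_map_eq_zero π₁).2 fun p hp => ?_
    have hp1 : (p : A × B).1 = 0 := hp
    have h := hagree _ (mul_mem (star_mem p.2) p.2)
    simp only [Prod.fst_mul, Prod.snd_mul, Prod.fst_star, Prod.snd_star, hp1, mul_zero,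
      map_zero] at h
    exact Subtype.ext (Prod.ext hp1 (hσ _ h.symm))
  have h₂ : Function.Injective π₂ := by
    refine (injective_iff_map_eq_zero π₂).2 fun p hp => ?_
    have hp2 : (p : A × B).2 = 0 := hp
    have h := hagree _ (mul_mem (star_mem p.2) p.2)
    simp only [Prod.fst_mul, Prod.snd_mul, Prod.fst_star, Prod.snd_star, hp2, mul_zero,
      map_zero] at h
    exact Subtype.ext (Prod.ext (hτ _ h) hp2)
  have s₁ : Function.Surjective π₁ :=
    NonUnitalStarAlgHom.surjective_of_span_dense π₁ h₁ hvd fun g => ⟨⟨_, hmem g⟩, rfl⟩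
  have s₂ : Function.Surjective π₂ :=
    NonUnitalStarAlgHom.surjective_of_span_dense π₂ h₂ hud fun g => ⟨⟨_, hmem g⟩, rfl⟩
  let e₁ := StarAlgEquiv.ofBijective π₁ ⟨h₁, s₁⟩
  let e₂ := StarAlgEquiv.ofBijective π₂ ⟨h₂, s₂⟩
  refine ⟨e₁.symm.trans e₂, fun g => ?_⟩
  have : e₁.symm (v g) = ⟨_, hmem g⟩ := e₁.symm_apply_eq.2 rfl
  rw [StarAlgEquiv.trans_apply, this]
  rfl

end TwistedRep

/-! ### Left convolution operators -/

section WeightedShift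

variable {X : Type*}

theorem EllTwo.summable_norm_sq (ξ : EllTwo X) : Summable fun x => ‖ξ x‖ ^ 2 := by
  have := (lp.memℓp ξ).summable (by norm_num)
  simpa using this

theorem EllTwo.norm_sq_eq_tsum (ξ : EllTwo X) : ‖ξ‖ ^ 2 = ∑' x, ‖ξ x‖ ^ 2 := by
  have := lp.norm_rpow_eq_tsum (p := 2) (by norm_num) ξ
  simpa using this

/-- The operator `ξ ↦ (x ↦ c x * ξ (e x))` on `ℓ²(X)`, for a permutation `e` of `X` and a function
`c` that is bounded by `C`. -/
noncomputable def weightedShift (e : X ≃ X) (c : X → ℂ) (C : ℝ) (hc : ∀ x, ‖c x‖ ≤ C) :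
    EllTwo X →L[ℂ] EllTwo X :=
  have hle (ξ : EllTwo X) (x : X) : ‖c x * ξ (e x)‖ ^ 2 ≤ C ^ 2 * ‖ξ (e x)‖ ^ 2 := by
    rw [norm_mul, mul_pow]
    gcongr
    exact hc x
  have hs (ξ : EllTwo X) : Summable fun x => C ^ 2 * ‖ξ (e x)‖ ^ 2 :=
    ((e.summable_iff (f := fun x => ‖ξ x‖ ^ 2)).2 (EllTwo.summable_norm_sq ξ)).mul_left _
  have hs' (ξ : EllTwo X) : Summable fun x => ‖c x * ξ (e x)‖ ^ 2 :=
    (hs ξ).of_nonneg_of_le (fun _ => by positivity) (hle ξ)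
  have hm (ξ : EllTwo X) : Memℓp (fun x => c x * ξ (e x)) 2 :=
    memℓp_gen (by simpa using hs' ξ)
  LinearMap.mkContinuous
    { toFun := fun ξ => ⟨fun x => c x * ξ (e x), hm ξ⟩
      map_add' := fun ξ η => by ext x; exact mul_add _ _ _
      map_smul' := fun r ξ => by ext x; exact mul_left_comm _ _ _ }
    |C| fun ξ => by
      refine (sq_le_sq₀ (norm_nonneg _) (by positivity)).1 ?_
      rw [mul_pow, sq_abs, EllTwo.norm_sq_eq_tsum, EllTwo.norm_sq_eq_tsum,
        ← e.tsum_eq (fun x => ‖ξ x‖ ^ 2), ← tsum_mul_left]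
      exact (hs' ξ).tsum_le_tsum (hle ξ) (hs ξ)

@[simp]
theorem weightedShift_apply (e : X ≃ X) (c : X → ℂ) (C : ℝ) (hc : ∀ x, ‖c x‖ ≤ C)
    (ξ : EllTwo X) (x : X) : weightedShift e c C hc ξ x = c x * ξ (e x) := rfl

theorem norm_weightedShift_le (e : X ≃ X) (c : X → ℂ) (C : ℝ) (hc : ∀ x, ‖c x‖ ≤ C) :
    ‖weightedShift e c C hc‖ ≤ |C| := by
  unfold weightedShift
  exact LinearMap.mkContinuous_norm_le _ (abs_nonneg _) _

theorem EllTwo.clm_ext {T S : EllTwo X →L[ℂ] EllTwo X} (h : ∀ ξ x, T ξ x = S ξ x) : T = S :=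
  ContinuousLinearMap.ext fun ξ => lp.ext (funext (h ξ))

open scoped InnerProductSpace in
/-- A shift with unimodular weights is unitary. -/
theorem star_weightedShift (e : X ≃ X) (c : X → Circle) {C D : ℝ}
    (hc : ∀ x, ‖(c x : ℂ)‖ ≤ C) (hd : ∀ x, ‖(((c (e.symm x))⁻¹ : Circle) : ℂ)‖ ≤ D) :
    star (weightedShift e (fun x => (c x : ℂ)) C hc) =
      weightedShift e.symm (fun x => (((c (e.symm x))⁻¹ : Circle) : ℂ)) D hd := by
  refine (ContinuousLinearMap.eq_adjoint_iff _ _).2 (fun ξ η => ?_) |>.symm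
  rw [lp.inner_eq_tsum, lp.inner_eq_tsum, ← e.tsum_eq]
  refine tsum_congr fun x => ?_
  simp only [weightedShift_apply, RCLike.inner_apply, Equiv.symm_apply_apply, map_mul]
  rw [Circle.coe_inv_eq_conj, Complex.conj_conj]
  ring

end WeightedShift

namespace EtaleGroupoid

variable {𝒢 : Type*} [TopologicalSpace 𝒢] {G : EtaleGroupoid 𝒢} {ω : G.TwoCocycle}

theorem IsLeftConvolution.unique {φ : 𝒢 → ℂ} {T S : EllTwo 𝒢 →L[ℂ] EllTwo 𝒢}
    (hT : IsLeftConvolution ω φ T) (hS : IsLeftConvolution ω φ S) : T = S :=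
  EllTwo.clm_ext fun ξ γ => (hT ξ γ).trans (hS ξ γ).symm

theorem IsLeftConvolution.mem_reducedCStar {φ : C_c(𝒢, ℂ)} {T : EllTwo 𝒢 →L[ℂ] EllTwo 𝒢}
    (hT : IsLeftConvolution ω φ T) : T ∈ reducedCStar ω :=
  NonUnitalStarSubalgebra.le_topologicalClosure _ (NonUnitalStarAlgebra.subset_adjoin ℂ _ ⟨φ, hT⟩)

end EtaleGroupoid

theorem isLeftConvolution_groupGroupoid_iff {G : Type*} [Group G] [TopologicalSpace G]
    [DiscreteTopology G] (ω : (groupGroupoid G).TwoCocycle) (φ : G → ℂ)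
    (T : EllTwo G →L[ℂ] EllTwo G) :
    EtaleGroupoid.IsLeftConvolution ω φ T ↔ ∀ (ξ : EllTwo G) (g : G),
      T ξ g = ∑ᶠ k, φ k * ξ (k⁻¹ * g) * (ω.toFun k (k⁻¹ * g) : ℂ) := by
  refine forall_congr' fun ξ => forall_congr' fun g => ?_
  have hset : {p : G × G | (groupGroupoid G).src p.1 = (groupGroupoid G).rng p.2 ∧
      (groupGroupoid G).mul p.1 p.2 = g} = Set.range fun k : G => (k, k⁻¹ * g) := by
    ext ⟨a, b⟩
    constructor
    · rintro ⟨-, h⟩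
      exact ⟨a, Prod.ext rfl (by rw [← show a * b = g from h]; exact inv_mul_cancel_left a b)⟩
    · rintro ⟨k, h⟩
      obtain ⟨rfl, rfl⟩ := Prod.ext_iff.1 h
      exact ⟨rfl, mul_inv_cancel_left k g⟩
  rw [hset, finsum_mem_range fun a b h => (Prod.ext_iff.1 h).1]

theorem isLeftConvolution_actionGroupoid_iff {K X : Type*} [Group K] [TopologicalSpace K]
    [DiscreteTopology K] [TopologicalSpace X] [T2Space X] [LocallyCompactSpace X]
    (α : K →* (X ≃ₜ X)) (ω : (actionGroupoid α).TwoCocycle) (φ : K × X → ℂ)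
    (T : EllTwo (K × X) →L[ℂ] EllTwo (K × X)) :
    EtaleGroupoid.IsLeftConvolution ω φ T ↔ ∀ (ξ : EllTwo (K × X)) (g : K × X),
      T ξ g = ∑ᶠ k, φ (k, α (k⁻¹ * g.1) g.2) * ξ (k⁻¹ * g.1, g.2) *
        (ω.toFun (k, α (k⁻¹ * g.1) g.2) (k⁻¹ * g.1, g.2) : ℂ) := by
  refine forall_congr' fun ξ => forall_congr' fun g => ?_
  have hset : {p : (K × X) × (K × X) | (actionGroupoid α).src p.1 = (actionGroupoid α).rng p.2 ∧
      (actionGroupoid α).mul p.1 p.2 = g} =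
      Set.range fun k : K => ((k, α (k⁻¹ * g.1) g.2), (k⁻¹ * g.1, g.2)) := by
    obtain ⟨l, x⟩ := g
    ext ⟨⟨a, y⟩, ⟨b, z⟩⟩
    constructor
    · rintro ⟨h1, h2⟩
      obtain rfl : y = α b z := (Prod.ext_iff.1 h1).2
      obtain rfl : a * b = l := (Prod.ext_iff.1 h2).1
      obtain rfl : z = x := (Prod.ext_iff.1 h2).2
      exact ⟨a, by simp⟩
    · rintro ⟨k, h⟩
      simp only [Prod.mk.injEq] at h
      obtain ⟨⟨rfl, rfl⟩, rfl, rfl⟩ := h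
      exact ⟨rfl, by simp [actionGroupoid]⟩
  rw [hset, finsum_mem_range fun a b h => (Prod.ext_iff.1 (Prod.ext_iff.1 h).1).1]

/-! ### Diagonal coefficients of operators -/

section DiagonalCoefficients

variable {X : Type*}

/-- In a unital C*-algebra, the formula for the adjoint follows from unitarity. -/
theorem IsTwistedRep.of_unitary {G A : Type*} [Group G] [CStarAlgebra A] {w : G → G → Circle}
    {v : G → A} (hmul : ∀ g h, v g * v h = (w g h : ℂ) • v (g * h)) (hone : v 1 = 1)
    (hstar : ∀ g, v g * star (v g) = 1) : IsTwistedRep w v where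
  mul_eq := hmul
  star_eq g := by
    have h : v g⁻¹ * v g = (w g⁻¹ g : ℂ) • 1 := by rw [hmul, inv_mul_cancel, hone]
    have h' : v g⁻¹ = (w g⁻¹ g : ℂ) • star (v g) := by
      rw [← mul_one (v g⁻¹), ← hstar g, ← mul_assoc, h, smul_mul_assoc, one_mul]
    rw [h', smul_smul, ← Circle.coe_mul, inv_mul_cancel, Circle.coe_one, one_smul]

theorem weightedShift_mul_star (e : X ≃ X) (c : X → Circle) {C : ℝ}
    (hc : ∀ x, ‖(c x : ℂ)‖ ≤ C) :
    weightedShift e (fun x => (c x : ℂ)) C hc *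
      star (weightedShift e (fun x => (c x : ℂ)) C hc) = 1 := by
  rw [star_weightedShift e c hc (D := 1) (fun x => (Circle.norm_coe _).le)]
  refine EllTwo.clm_ext fun ξ x => ?_
  rw [mul_apply_eq_comp, weightedShift_apply, weightedShift_apply,
    Equiv.symm_apply_apply, ← mul_assoc, ← Circle.coe_mul, mul_inv_cancel]
  simp

open Classical in
/-- The diagonal matrix coefficient `⟨δ_x, T δ_x⟩` of an operator `T` on `ℓ²(X)`. -/
noncomputable def diagCoeff (x : X) : (EllTwo X →L[ℂ] EllTwo X) →L[ℂ] ℂ :=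
  (innerSL ℂ (lp.single 2 x (1 : ℂ) : EllTwo X)) ∘L
    ContinuousLinearMap.apply ℂ (EllTwo X) (lp.single 2 x (1 : ℂ) : EllTwo X)

theorem diagCoeff_apply [DecidableEq X] (x : X) (T : EllTwo X →L[ℂ] EllTwo X) :
    diagCoeff x T = T (lp.single 2 x 1) x := by
  obtain rfl : ‹DecidableEq X› = fun a b => Classical.propDecidable (a = b) :=
    Subsingleton.elim _ _
  simp [diagCoeff, lp.inner_single_left]

theorem norm_diagCoeff_apply_le (x : X) (T : EllTwo X →L[ℂ] EllTwo X) :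
    ‖diagCoeff x T‖ ≤ ‖T‖ := by
  classical
  refine (norm_inner_le_norm (𝕜 := ℂ) (lp.single 2 x (1 : ℂ) : EllTwo X) _).trans ?_
  have h1 : ‖(lp.single 2 x (1 : ℂ) : EllTwo X)‖ = 1 := by
    rw [lp.norm_single (by norm_num)]; simp
  rw [h1, one_mul]
  exact (T.le_opNorm _).trans (by rw [h1, mul_one])

open Classical in
theorem diagCoeff_star_mul_self (x : X) (T : EllTwo X →L[ℂ] EllTwo X) :
    diagCoeff x (star T * T) = ((‖T (lp.single 2 x 1)‖ ^ 2 : ℝ) : ℂ) := by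
  have : diagCoeff x (star T * T) =
      inner ℂ (T (lp.single 2 x (1 : ℂ))) (T (lp.single 2 x (1 : ℂ))) :=
    ContinuousLinearMap.adjoint_inner_right T _ _
  rw [this, inner_self_eq_norm_sq_to_K]
  simp

theorem eq_zero_of_diagCoeff_star_mul_self {T : EllTwo X →L[ℂ] EllTwo X}
    (h : ∀ x, diagCoeff x (star T * T) = 0) : T = 0 := by
  classical
  have h0 (x : X) (a : ℂ) : T (lp.single 2 x a) = 0 := by
    have := h x
    rw [diagCoeff_star_mul_self] at this
    have h1 : T (lp.single 2 x (1 : ℂ)) = 0 := by simpa using this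
    have h2 : (lp.single 2 x a : EllTwo X) = a • lp.single 2 x (1 : ℂ) := by
      rw [← lp.single_smul]; simp
    rw [h2, map_smul, h1, smul_zero]
  refine ContinuousLinearMap.ext fun ξ => ?_
  have := (lp.hasSum_single (by norm_num) ξ).mapL T
  simp only [h0] at this
  exact this.unique hasSum_zero

theorem diagCoeff_weightedShift (e : X ≃ X) (c : X → ℂ) (C : ℝ) (hc : ∀ x, ‖c x‖ ≤ C) (x : X)
    [Decidable (e x = x)] :
    diagCoeff x (weightedShift e c C hc) = if e x = x then c x else 0 := by
  classical
  rw [diagCoeff_apply, weightedShift_apply, lp.single_apply, Pi.single_apply]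
  split_ifs <;> simp

theorem NonUnitalStarSubalgebra.dense_span_of_le {A I : Type*} [NonUnitalCStarAlgebra A]
    (S : NonUnitalStarSubalgebra ℂ A) (v : I → S)
    (h : (S : Set A) ⊆ closure (Submodule.span ℂ (Set.range fun i => (v i : A)))) :
    Dense (Submodule.span ℂ (Set.range v) : Set S) := by
  refine Subtype.dense_iff.2 (h.trans (closure_mono ?_))
  have hm : Submodule.span ℂ (Set.range fun i => (v i : A)) =
      (Submodule.span ℂ (Set.range v)).map (NonUnitalStarSubalgebraClass.subtype S : S →ₗ[ℂ] A) := by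
    rw [Submodule.map_span, ← Set.range_comp]
    rfl
  rw [hm]
  rintro _ ⟨y, hy, rfl⟩
  exact ⟨y, hy, rfl⟩

end DiagonalCoefficients

/-! ### The C*-algebra of a discrete group -/

theorem CompactlySupportedContinuousMap.finite_support_of_discrete {X : Type*}
    [TopologicalSpace X] [DiscreteTopology X] (φ : C_c(X, ℂ)) :
    (Function.support φ).Finite :=
  φ.hasCompactSupport.isCompact.finite_of_discrete.subset (subset_tsupport _)

section GroupAlgebra

variable {G : Type*} [Group G] [TopologicalSpace G] [DiscreteTopology G]
  (ω : (groupGroupoid G).TwoCocycle)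

/-- The operator of left convolution with the point mass at `g`. -/
noncomputable def pointMassOp (g : G) : EllTwo G →L[ℂ] EllTwo G :=
  weightedShift (Equiv.mulLeft g⁻¹) (fun x => (ω.toFun g (g⁻¹ * x) : ℂ)) 1
    fun _ => (Circle.norm_coe _).le

theorem pointMassOp_apply (g : G) (ξ : EllTwo G) (x : G) :
    pointMassOp ω g ξ x = (ω.toFun g (g⁻¹ * x) : ℂ) * ξ (g⁻¹ * x) := rfl

theorem isLeftConvolution_pointMassOp (g : G) :
    EtaleGroupoid.IsLeftConvolution ω (Set.indicator {g} 1) (pointMassOp ω g) := by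
  rw [isLeftConvolution_groupGroupoid_iff]
  intro ξ x
  rw [finsum_eq_single _ g fun k hk => by simp [hk]]
  simp [pointMassOp_apply, mul_comm]

/-- On a discrete group, convolution with a compactly supported function is a finite linear
combination of convolutions with point masses. -/
theorem EtaleGroupoid.IsLeftConvolution.eq_sum_pointMassOp {φ : G → ℂ} (F : Finset G)
    (hF : ∀ g, φ g ≠ 0 → g ∈ F) {T : EllTwo G →L[ℂ] EllTwo G}
    (hT : EtaleGroupoid.IsLeftConvolution ω φ T) : T = ∑ g ∈ F, φ g • pointMassOp ω g := by
  rw [isLeftConvolution_groupGroupoid_iff] at hT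
  refine EllTwo.clm_ext fun ξ x => ?_
  rw [hT, finsum_eq_sum_of_support_subset (s := F)]
  · simp only [sum_apply, lp.coeFn_sum, Finset.sum_apply,
      smul_apply, lp.coeFn_smul, Pi.smul_apply, pointMassOp_apply,
      smul_eq_mul]
    exact Finset.sum_congr rfl fun k _ => by ring
  · intro k hk
    refine hF k fun h => hk ?_
    simp [h]

theorem pointMassOp_mem (g : G) : pointMassOp ω g ∈ EtaleGroupoid.reducedCStar ω := by
  have hφ : HasCompactSupport (Set.indicator {g} (1 : G → ℂ)) :=
    HasCompactSupport.intro (K := {g}) isCompact_singleton fun x hx => by simp_all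
  exact EtaleGroupoid.IsLeftConvolution.mem_reducedCStar
    (φ := ⟨⟨Set.indicator {g} 1, continuous_of_discreteTopology⟩, hφ⟩)
    (isLeftConvolution_pointMassOp ω g)

/-- The point mass at `g` as an element of the twisted group C*-algebra. -/
noncomputable def pointMass (g : G) : EtaleGroupoid.reducedCStar ω :=
  ⟨pointMassOp ω g, pointMassOp_mem ω g⟩

variable {ω}

theorem EtaleGroupoid.TwoCocycle.one_left (h1 : ω.toFun 1 1 = 1) (g : G) : ω.toFun 1 g = 1 := by
  have := ω.cocycle 1 1 g rfl rfl
  simpa [groupGroupoid, h1] using this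

theorem isTwistedRep_pointMassOp (h1 : ω.toFun 1 1 = 1) :
    IsTwistedRep ω.toFun (pointMassOp ω) := by
  refine .of_unitary (fun g h => ?_) ?_ fun g => weightedShift_mul_star _ _ _
  · refine EllTwo.clm_ext fun ξ x => ?_
    have e : (ω.toFun g (g⁻¹ * x) : ℂ) * ω.toFun h (h⁻¹ * (g⁻¹ * x)) =
        ω.toFun (g * h) (h⁻¹ * (g⁻¹ * x)) * ω.toFun g h := by
      have := ω.cocycle g h (h⁻¹ * (g⁻¹ * x)) rfl rfl
      simp only [groupGroupoid, mul_inv_cancel_left] at this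
      rw [← Circle.coe_mul, this, Circle.coe_mul]
    simp only [mul_apply_eq_comp, pointMassOp_apply, smul_apply,
      lp.coeFn_smul, Pi.smul_apply, smul_eq_mul]
    rw [show (g * h)⁻¹ * x = h⁻¹ * (g⁻¹ * x) by group]
    linear_combination e * ξ (h⁻¹ * (g⁻¹ * x))
  · refine EllTwo.clm_ext fun ξ x => ?_
    simp [pointMassOp_apply, EtaleGroupoid.TwoCocycle.one_left h1]

theorem isTwistedRep_pointMass (h1 : ω.toFun 1 1 = 1) :
    IsTwistedRep ω.toFun (pointMass ω) where
  mul_eq g h := Subtype.ext ((isTwistedRep_pointMassOp h1).mul_eq g h)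
  star_eq g := Subtype.ext ((isTwistedRep_pointMassOp h1).star_eq g)

theorem dense_span_pointMass (h1 : ω.toFun 1 1 = 1) :
    Dense (Submodule.span ℂ (Set.range (pointMass ω)) :
      Set (EtaleGroupoid.reducedCStar ω)) := by
  refine NonUnitalStarSubalgebra.dense_span_of_le _ _ (closure_mono ?_)
  refine NonUnitalStarAlgebra.adjoin_le (S := (isTwistedRep_pointMassOp h1).span) ?_
  rintro T ⟨φ, hT⟩
  rw [hT.eq_sum_pointMassOp ω φ.finite_support_of_discrete.toFinset fun g hg => by simpa using hg]
  exact sum_mem fun g _ => SMulMemClass.smul_mem _ ((isTwistedRep_pointMassOp h1).mem_span g)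

/-- The canonical trace `T ↦ ⟨δ_1, T δ_1⟩` of the twisted group C*-algebra. -/
noncomputable def groupTrace (ω : (groupGroupoid G).TwoCocycle) :
    EtaleGroupoid.reducedCStar ω →L[ℂ] ℂ :=
  diagCoeff 1 ∘L (EtaleGroupoid.reducedCStar ω).toSubmodule.subtypeL

theorem groupTrace_pointMass [DecidableEq G] (h1 : ω.toFun 1 1 = 1) (g : G) :
    groupTrace ω (pointMass ω g) = if g = 1 then 1 else 0 := by
  classical
  change diagCoeff 1 (pointMassOp ω g) = _
  rw [pointMassOp, diagCoeff_weightedShift]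
  by_cases hg : g = 1
  · simp [hg, h1]
  · simp [hg]

/-- All diagonal coefficients of an element of the twisted group C*-algebra are equal. -/
theorem diagCoeff_eq_groupTrace (h1 : ω.toFun 1 1 = 1) (g : G)
    (a : EtaleGroupoid.reducedCStar ω) : diagCoeff g (a : EllTwo G →L[ℂ] EllTwo G) =
      groupTrace ω a := by
  classical
  have : diagCoeff g ∘L (EtaleGroupoid.reducedCStar ω).toSubmodule.subtypeL = groupTrace ω := by
    refine ContinuousLinearMap.ext_on (dense_span_pointMass h1) ?_
    rintro _ ⟨k, rfl⟩
    rw [groupTrace_pointMass h1]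
    change diagCoeff g (pointMassOp ω k) = _
    rw [pointMassOp, diagCoeff_weightedShift]
    by_cases hk : k = 1
    · simp [hk, EtaleGroupoid.TwoCocycle.one_left h1]
    · simp [hk]
  exact DFunLike.congr_fun this a

theorem eq_zero_of_groupTrace (h1 : ω.toFun 1 1 = 1) (a : EtaleGroupoid.reducedCStar ω)
    (ha : groupTrace ω (star a * a) = 0) : a = 0 :=
  Subtype.ext (eq_zero_of_diagCoeff_star_mul_self fun g =>
    (diagCoeff_eq_groupTrace h1 g (star a * a)).trans ha)

end GroupAlgebra

/-! ### Continuous functions on the dual of a discrete Abelian group -/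

section Dual

variable {H : Type*} [CommGroup H] [TopologicalSpace H]

/-- The characters of a discrete Abelian group separate its points. -/
theorem PontryaginDual.exists_apply_ne_one [DiscreteTopology H] {h : H} (hh : h ≠ 1) :
    ∃ x : PontryaginDual H, x h ≠ 1 := by
  obtain ⟨c, hc⟩ := CharacterModule.exists_character_apply_ne_zero_of_ne_zero
    (A := Additive H) (a := Additive.ofMul h) (by simpa using hh)
  let f : ℚ →+ Additive Circle :=
    { toFun := fun q => Additive.ofMul (Circle.exp (2 * Real.pi * q))
      map_zero' := by simp
      map_add' := fun a b => by
        rw [← ofMul_mul, ← Circle.exp_add]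
        push_cast
        rw [mul_add] }
  have hf : AddSubgroup.zmultiples (1 : ℚ) ≤ f.ker := by
    rw [AddSubgroup.zmultiples_le]
    change Additive.ofMul (Circle.exp (2 * Real.pi * ((1 : ℚ) : ℝ))) = 0
    simp
  let F : AddCircle (1 : ℚ) →+ Additive Circle := QuotientAddGroup.lift _ f hf
  have hF (y : AddCircle (1 : ℚ)) (hy : F y = 0) : y = 0 := by
    obtain ⟨q, rfl⟩ := QuotientAddGroup.mk_surjective y
    have hq : Circle.exp (2 * Real.pi * q) = Circle.exp 0 := by
      rw [Circle.exp_zero]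
      exact hy
    obtain ⟨m, hm⟩ := Circle.exp_eq_exp.1 hq
    have hqm : (q : ℝ) = m := by
      have := Real.pi_pos
      have : 2 * Real.pi * ((q : ℝ) - m) = 0 := by linarith
      rcases mul_eq_zero.1 this with h | h <;> linarith
    refine (QuotientAddGroup.eq_zero_iff q).2 (AddSubgroup.mem_zmultiples_iff.2 ⟨m, ?_⟩)
    have : q = m := by exact_mod_cast hqm
    simp [this]
  let χ : H →* Circle :=
    { toFun := fun a => (F (c (Additive.ofMul a))).toMul
      map_one' := by simp
      map_mul' := fun a b => by rw [ofMul_mul, map_add, map_add, toMul_add] }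
  exact ⟨(show H →ₜ* Circle from ⟨χ, continuous_of_discreteTopology⟩), fun h1 => hc (hF _ h1)⟩

variable [DiscreteTopology H]

theorem evalDual_apply (h : H) (x : PontryaginDual H) : evalDual h x = (x h : ℂ) := rfl

theorem evalDual_one : evalDual (1 : H) = 1 := by
  ext x
  simp [evalDual_apply]

theorem isTwistedRep_evalDual :
    IsTwistedRep (fun _ _ : H => 1) (evalDual : H → C(PontryaginDual H, ℂ)) := by
  refine .of_unitary (fun g h => ?_) evalDual_one fun g => ?_
  · ext x
    simp [evalDual_apply]
  · ext x
    simp only [ContinuousMap.mul_apply, ContinuousMap.star_apply, evalDual_apply,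
      ContinuousMap.one_apply]
    rw [← starRingEnd_apply, ← Circle.coe_inv_eq_conj, ← Circle.coe_mul, mul_inv_cancel,
      Circle.coe_one]

/-- Trigonometric polynomials are dense, by the Stone-Weierstrass theorem. -/
theorem dense_span_evalDual :
    Dense (Submodule.span ℂ (Set.range (evalDual (H := H))) :
      Set C(PontryaginDual H, ℂ)) := by
  let S : StarSubalgebra ℂ C(PontryaginDual H, ℂ) :=
    (isTwistedRep_evalDual (H := H)).span.toStarSubalgebra
      (evalDual_one (H := H) ▸ isTwistedRep_evalDual.mem_span 1)
  have hS : S.SeparatesPoints := by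
    intro x y hxy
    obtain ⟨h, hh⟩ : ∃ h, x h ≠ y h := by
      by_contra! hc
      exact hxy (PontryaginDual.ext hc)
    exact ⟨_, ⟨evalDual h, isTwistedRep_evalDual.mem_span h, rfl⟩,
      fun e => hh (Circle.ext e)⟩
  have := ContinuousMap.starSubalgebra_topologicalClosure_eq_top_of_separatesPoints S hS
  rw [dense_iff_closure_eq]
  exact congrArg (SetLike.coe) this

open MeasureTheory in
/-- The Haar integral on the dual group: it vanishes on nontrivial characters, and is faithful. -/
theorem exists_haarFunctional [DecidableEq H] : ∃ σ : C(PontryaginDual H, ℂ) →L[ℂ] ℂ,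
    (∀ h, σ (evalDual h) = if h = 1 then 1 else 0) ∧ ∀ f, σ (star f * f) = 0 → f = 0 := by
  let _ : MeasurableSpace (PontryaginDual H) := borel _
  have : BorelSpace (PontryaginDual H) := ⟨rfl⟩
  let μ : Measure (PontryaginDual H) := Measure.haarMeasure ⊤
  have hμ : μ Set.univ = 1 := Measure.haarMeasure_self (K₀ := ⊤)
  have : IsProbabilityMeasure μ := ⟨hμ⟩
  have hint (f : C(PontryaginDual H, ℂ)) : Integrable f μ :=
    f.continuous.integrable_of_hasCompactSupport (HasCompactSupport.of_compactSpace f)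
  let σ : C(PontryaginDual H, ℂ) →L[ℂ] ℂ := LinearMap.mkContinuous
    { toFun := fun f => ∫ x, f x ∂μ
      map_add' := fun f g => integral_add (hint f) (hint g)
      map_smul' := fun c f => integral_const_mul c f } 1 fun f => by
        have := norm_integral_le_of_norm_le_const (μ := μ) (f := f)
          (Filter.Eventually.of_forall f.norm_coe_le_norm)
        simpa using this
  have hσ (f : C(PontryaginDual H, ℂ)) : σ f = ∫ x, f x ∂μ := rfl
  refine ⟨σ, fun h => ?_, fun f hf => ?_⟩
  · split_ifs with hh
    · rw [hσ, hh, evalDual_one]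
      simp
    · obtain ⟨y, hy⟩ := PontryaginDual.exists_apply_ne_one hh
      have h1 : ∫ x, evalDual h (y * x) ∂μ = σ (evalDual h) := integral_mul_left_eq_self _ y
      have h2 : ∫ x, evalDual h (y * x) ∂μ = (y h : ℂ) * σ (evalDual h) :=
        integral_const_mul (y h : ℂ) (evalDual h)
      have h3 : ((y h : ℂ) - 1) * σ (evalDual h) = 0 := by
        rw [sub_mul, ← h2, h1, one_mul, sub_self]
      refine (mul_eq_zero.1 h3).resolve_left fun h4 => hy (Circle.ext ?_)
      rw [sub_eq_zero.1 h4, Circle.coe_one]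
  · have hsq (x : PontryaginDual H) : (star f * f) x = ((‖f x‖ ^ 2 : ℝ) : ℂ) := by
      rw [ContinuousMap.mul_apply, ContinuousMap.star_apply, ← starRingEnd_apply,
        Complex.conj_mul']
      push_cast
      rfl
    rw [hσ] at hf
    simp only [hsq] at hf
    rw [integral_complex_ofReal, Complex.ofReal_eq_zero,
      integral_eq_zero_iff_of_nonneg (fun x => by positivity)] at hf
    · have hc : Continuous fun x => ‖f x‖ ^ 2 := by fun_prop
      have := (hc.ae_eq_iff_eq μ continuous_zero).1 hf
      ext x
      simpa using congrFun this x
    · have := (hint (star f * f)).norm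
      simp only [hsq] at this
      simpa using this

end Dual

/-! ### The C*-algebra of the action groupoid -/

section ActionAlgebra

open SemidirectProduct

variable {H K : Type*} [CommGroup H] [CommGroup K] [TopologicalSpace H] [TopologicalSpace K]
  [DiscreteTopology H] [DiscreteTopology K] {β : K →* MulAut H}

section Slice

variable {X : Type*} [TopologicalSpace X] [CompactSpace X]
  (ω : (groupGroupoid (H ⋊[β] K)).TwoCocycle) (α : K →* (X ≃ₜ X))

/-- Left convolution with the function `(k, y) ↦ f y`, supported in the slice `{k} × X` of the
action groupoid. -/
noncomputable def sliceOp (k : K) (f : C(X, ℂ)) : EllTwo (K × X) →L[ℂ] EllTwo (K × X) :=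
  weightedShift ((Equiv.mulLeft k⁻¹).prodCongr (Equiv.refl X))
    (fun p => f (α (k⁻¹ * p.1) p.2) * (ω.toFun (inr k) (inr (k⁻¹ * p.1)) : ℂ)) ‖f‖ fun p => by
      rw [norm_mul, Circle.norm_coe, mul_one]
      exact f.norm_coe_le_norm _

theorem sliceOp_apply (k : K) (f : C(X, ℂ)) (ξ : EllTwo (K × X)) (p : K × X) :
    sliceOp ω α k f ξ p = f (α (k⁻¹ * p.1) p.2) *
      (ω.toFun (inr k) (inr (k⁻¹ * p.1)) : ℂ) * ξ (k⁻¹ * p.1, p.2) := rfl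

/-- `sliceOp` as a continuous linear map in the function. -/
noncomputable def sliceCLM (k : K) : C(X, ℂ) →L[ℂ] EllTwo (K × X) →L[ℂ] EllTwo (K × X) :=
  LinearMap.mkContinuous
    { toFun := sliceOp ω α k
      map_add' := fun f g => EllTwo.clm_ext fun ξ p => by
        change sliceOp ω α k (f + g) ξ p = sliceOp ω α k f ξ p + sliceOp ω α k g ξ p
        simp only [sliceOp_apply, ContinuousMap.add_apply]
        ring
      map_smul' := fun c f => EllTwo.clm_ext fun ξ p => by
        change sliceOp ω α k (c • f) ξ p = c * sliceOp ω α k f ξ p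
        simp only [sliceOp_apply, ContinuousMap.smul_apply, smul_eq_mul]
        ring } 1 fun f => by
      rw [one_mul]
      change ‖sliceOp ω α k f‖ ≤ ‖f‖
      exact (norm_weightedShift_le _ _ _ _).trans_eq (abs_norm f)

variable [T2Space X]

open Classical in
theorem isLeftConvolution_sliceOp (k : K) (f : C(X, ℂ)) :
    EtaleGroupoid.IsLeftConvolution (restrictCocycle ω α)
      (fun p : K × X => if p.1 = k then f p.2 else 0) (sliceOp ω α k f) := by
  rw [isLeftConvolution_actionGroupoid_iff]
  intro ξ p
  rw [finsum_eq_single _ k fun l hl => by simp [hl], sliceOp_apply, if_pos rfl]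
  simp only [restrictCocycle]
  ring

theorem sliceOp_mem (k : K) (f : C(X, ℂ)) :
    sliceOp ω α k f ∈ EtaleGroupoid.reducedCStar (restrictCocycle ω α) := by
  classical
  have hc : Continuous fun p : K × X => if p.1 = k then f p.2 else 0 := by
    refine continuous_prod_of_discrete_left.2 fun l => ?_
    by_cases h : l = k
    · simpa [h] using f.continuous
    · simpa [h] using continuous_const
  have hs : HasCompactSupport fun p : K × X => if p.1 = k then f p.2 else 0 :=
    HasCompactSupport.intro (K := {k} ×ˢ Set.univ) (isCompact_singleton.prod isCompact_univ)
      fun p hp => if_neg fun h => hp ⟨h, trivial⟩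
  exact EtaleGroupoid.IsLeftConvolution.mem_reducedCStar (φ := ⟨⟨_, hc⟩, hs⟩)
    (isLeftConvolution_sliceOp ω α k f)

/-- A compactly supported function on the action groupoid lives on finitely many slices. -/
theorem exists_eq_sum_sliceOp (φ : C_c(K × X, ℂ)) {T : EllTwo (K × X) →L[ℂ] EllTwo (K × X)}
    (hT : EtaleGroupoid.IsLeftConvolution (restrictCocycle ω α) φ T) :
    ∃ (F : Finset K) (f : K → C(X, ℂ)), T = ∑ k ∈ F, sliceOp ω α k (f k) := by
  have hfin : (Prod.fst '' tsupport φ).Finite :=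
    (φ.hasCompactSupport.isCompact.image continuous_fst).finite_of_discrete
  refine ⟨hfin.toFinset, fun k => ⟨fun x => φ (k, x), by fun_prop⟩, ?_⟩
  rw [isLeftConvolution_actionGroupoid_iff] at hT
  refine EllTwo.clm_ext fun ξ p => ?_
  rw [hT, finsum_eq_sum_of_support_subset (s := hfin.toFinset)]
  · simp only [sum_apply, lp.coeFn_sum, Finset.sum_apply, sliceOp_apply, ContinuousMap.coe_mk]
    refine Finset.sum_congr rfl fun k _ => ?_
    simp only [restrictCocycle]
    ring
  · intro k hk
    rw [Set.Finite.coe_toFinset]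
    refine ⟨(k, α (k⁻¹ * p.1) p.2), subset_tsupport _ fun h => hk ?_, rfl⟩
    change φ _ * _ * _ = 0
    rw [h, zero_mul, zero_mul]

end Slice

/-- The value of a cocycle on the products `(a h, b h')`, where `c = b⁻¹ h b` and the cocycle is
trivial on `(c, h')`. -/
theorem addCocycle_mul_mul {G M : Type*} [Group G] [AddCommGroup M] (u : G → G → M)
    (hu : ∀ a b c, u a (b * c) + u b c = u (a * b) c + u a b) {a h b h' c : G}
    (hc : h * b = b * c) (h0 : u c h' = 0) :
    u (a * h) (b * h') = -u a h - u b h' + u a b + (u h b - u b c) + u (a * b) (c * h') := by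
  have e1 := hu a h (b * h')
  have e2 := hu h b h'
  have e3 := hu b c h'
  have e4 := hu a b (c * h')
  rw [← mul_assoc, hc, mul_assoc] at e1
  rw [hc] at e2
  grind

variable (ω : (groupGroupoid (H ⋊[β] K)).TwoCocycle)

theorem toFun_one_one (hω : ∀ h h' : H, ω.toFun (inl h) (inl h') = 1) : ω.toFun 1 1 = 1 := by
  simpa using hω 1 1

/-- The cocycle in terms of its restriction to `K`, its values on `K × H`, and the factors of the
dual action, for the factorizations `g = (1, k) (h, 1)` of group elements. -/
theorem cocycle_mul_eq (hω : ∀ h h' : H, ω.toFun (inl h) (inl h') = 1) (g g' : H ⋊[β] K) :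
    ω.toFun g g' = (ω.toFun (inr g.right) (inl (β g.right⁻¹ g.left)))⁻¹ *
      (ω.toFun (inr g'.right) (inl (β g'.right⁻¹ g'.left)))⁻¹ *
      ω.toFun (inr g.right) (inr g'.right) * conjFactor ω g'.right (β g.right⁻¹ g.left) *
      ω.toFun (inr (g.right * g'.right))
        (inl (β (g.right * g'.right)⁻¹ (g.left * β g.right g'.left))) := by
  have hfac (g : H ⋊[β] K) : g = inr g.right * inl (β g.right⁻¹ g.left) := by
    ext <;> simp
  have hc : (inl (β g.right⁻¹ g.left) : H ⋊[β] K) * inr g'.right =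
      inr g'.right * inl (β g'.right⁻¹ (β g.right⁻¹ g.left)) := by
    rw [← inr_conj_inl g'.right]
    group
  have h2 : (inl (β (g.right * g'.right)⁻¹ (g.left * β g.right g'.left)) : H ⋊[β] K) =
      inl (β g'.right⁻¹ (β g.right⁻¹ g.left)) * inl (β g'.right⁻¹ g'.left) := by
    rw [← map_mul, map_mul (β _), ← MulAut.mul_apply, ← MulAut.mul_apply, ← map_mul, ← map_mul]
    congr 3 <;> simp [mul_comm]
  have key := addCocycle_mul_mul (fun a b => Additive.ofMul (ω.toFun a b))
    (fun a b c => congrArg Additive.ofMul (ω.cocycle a b c rfl rfl)) (a := inr g.right)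
    (b := inr g'.right) (h' := inl (β g'.right⁻¹ g'.left)) hc
    (congrArg Additive.ofMul (hω _ _))
  have hconj := ofMul_conjFactor ω hω g'.right (β g.right⁻¹ g.left)
  rw [inr_conj_inl] at hconj
  rw [← hfac, ← hfac, ← hconj, ← h2, ← map_mul] at key
  simp only [sub_eq_add_neg, ← ofMul_inv, ← ofMul_mul] at key
  exact Additive.ofMul.injective key

variable (hω : ∀ h h' : H, ω.toFun (inl h) (inl h') = 1)

/-- The function by which the canonical unitary `unitaryOp ω hω g` multiplies. -/
noncomputable def unitaryWeight (g : H ⋊[β] K) (p : K × PontryaginDual H) : Circle :=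
  (ω.toFun (inr g.right) (inl (β g.right⁻¹ g.left)))⁻¹ *
    dualAction ω hω (g.right⁻¹ * p.1) p.2 (β g.right⁻¹ g.left) *
    ω.toFun (inr g.right) (inr (g.right⁻¹ * p.1))

/-- The operator on `ℓ²(K × Ĥ)` that corresponds to the point mass at `g`. With `g` written as
`(1, k) (h, 1)`, it is the product of left convolution with the indicator function of `{k} × Ĥ` and
of multiplication with the function `x ↦ x h`, up to the scalar that `ω` dictates. -/
noncomputable def unitaryOp (g : H ⋊[β] K) :
    EllTwo (K × PontryaginDual H) →L[ℂ] EllTwo (K × PontryaginDual H) :=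
  weightedShift ((Equiv.mulLeft g.right⁻¹).prodCongr (Equiv.refl _))
    (fun p => (unitaryWeight ω hω g p : ℂ)) 1 fun _ => (Circle.norm_coe _).le

theorem unitaryOp_apply (g : H ⋊[β] K) (ξ : EllTwo (K × PontryaginDual H))
    (p : K × PontryaginDual H) : unitaryOp ω hω g ξ p =
      (unitaryWeight ω hω g p : ℂ) * ξ (g.right⁻¹ * p.1, p.2) := rfl

theorem unitaryOp_eq_smul_sliceOp (g : H ⋊[β] K) :
    unitaryOp ω hω g = (((ω.toFun (inr g.right) (inl (β g.right⁻¹ g.left)))⁻¹ : Circle) : ℂ) •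
      sliceOp ω (dualAction ω hω) g.right (evalDual (β g.right⁻¹ g.left)) := by
  refine EllTwo.clm_ext fun ξ p => ?_
  rw [unitaryOp_apply, smul_apply, lp.coeFn_smul, Pi.smul_apply, sliceOp_apply, evalDual_apply,
    unitaryWeight, smul_eq_mul, Circle.coe_mul, Circle.coe_mul]
  ring

theorem dualAction_apply (k : K) (x : PontryaginDual H) (h : H) :
    dualAction ω hω k x h = conjFactor ω k h * x (β k⁻¹ h) := rfl

/-- The dual action is defined so that the canonical unitaries multiply according to `ω`. -/
theorem unitaryWeight_mul (g g' : H ⋊[β] K) (p : K × PontryaginDual H) :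
    unitaryWeight ω hω g p * unitaryWeight ω hω g' (g.right⁻¹ * p.1, p.2) =
      ω.toFun g g' * unitaryWeight ω hω (g * g') p := by
  obtain ⟨l, x⟩ := p
  have e1 : dualAction ω hω (g.right⁻¹ * l) x =
      dualAction ω hω g'.right (dualAction ω hω (g'.right⁻¹ * (g.right⁻¹ * l)) x) := by
    rw [← Homeomorph.mul_apply, ← map_mul, mul_inv_cancel_left]
  have e2 : β (g.right * g'.right)⁻¹ (g.left * β g.right g'.left) =
      β g'.right⁻¹ (β g.right⁻¹ g.left) * β g'.right⁻¹ g'.left := by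
    rw [map_mul, ← MulAut.mul_apply, ← MulAut.mul_apply, ← map_mul, ← map_mul]
    congr 3 <;> simp [mul_comm]
  have e3 : (g.right * g'.right)⁻¹ * l = g'.right⁻¹ * (g.right⁻¹ * l) := by group
  have e4 : ω.toFun (inr g.right) (inr (g.right⁻¹ * l)) *
      ω.toFun (inr g'.right) (inr (g'.right⁻¹ * (g.right⁻¹ * l))) =
      ω.toFun (inr (g.right * g'.right)) (inr (g'.right⁻¹ * (g.right⁻¹ * l))) *
        ω.toFun (inr g.right) (inr g'.right) := by
    have := ω.cocycle (inr g.right) (inr g'.right) (inr (g'.right⁻¹ * (g.right⁻¹ * l))) rfl rfl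
    simpa only [groupGroupoid, ← map_mul, mul_inv_cancel_left] using this
  rw [cocycle_mul_eq ω hω g g']
  simp only [unitaryWeight, mul_right, mul_left]
  rw [e1, e2, e3, dualAction_apply ω hω g'.right]
  generalize dualAction ω hω (g'.right⁻¹ * (g.right⁻¹ * l)) x = y
  rw [map_mul y]
  have key {M : Type} [CommGroup M] {a b c d y z p q r s : M} (h : p * q = r * s) :
      a⁻¹ * (c * y) * p * (b⁻¹ * z * q) = a⁻¹ * b⁻¹ * s * c * d * (d⁻¹ * (y * z) * r) := by
    calc a⁻¹ * (c * y) * p * (b⁻¹ * z * q) = a⁻¹ * b⁻¹ * c * y * z * (p * q) := by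
          simp only [mul_comm, mul_left_comm, mul_assoc]
      _ = a⁻¹ * b⁻¹ * c * y * z * (r * s) * (d * d⁻¹) := by rw [h, mul_inv_cancel, mul_one]
      _ = _ := by simp only [mul_comm, mul_left_comm, mul_assoc]
  exact key e4

end ActionAlgebra

/-! ### Canonical unitaries and the conditional expectation onto `C(Ĥ)` -/

section CanonicalUnitaries

open SemidirectProduct

variable {H K : Type*} [CommGroup H] [CommGroup K] [TopologicalSpace H] [TopologicalSpace K]
  [DiscreteTopology H] [DiscreteTopology K] {β : K →* MulAut H}
  (ω : (groupGroupoid (H ⋊[β] K)).TwoCocycle)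
  (hω : ∀ h h' : H, ω.toFun (inl h) (inl h') = 1)

theorem isTwistedRep_unitaryOp : IsTwistedRep ω.toFun (unitaryOp ω hω) := by
  have h1 := toFun_one_one ω hω
  refine .of_unitary (fun g g' => ?_) ?_ fun g => weightedShift_mul_star _ _ _
  · refine EllTwo.clm_ext fun ξ p => ?_
    have e : (unitaryWeight ω hω g p : ℂ) * unitaryWeight ω hω g' (g.right⁻¹ * p.1, p.2) =
        ω.toFun g g' * unitaryWeight ω hω (g * g') p := by
      rw [← Circle.coe_mul, unitaryWeight_mul, Circle.coe_mul]
    rw [mul_apply_eq_comp, smul_apply, lp.coeFn_smul, Pi.smul_apply, unitaryOp_apply,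
      unitaryOp_apply, unitaryOp_apply, smul_eq_mul, mul_right,
      show (g.right * g'.right)⁻¹ * p.1 = g'.right⁻¹ * (g.right⁻¹ * p.1) by group]
    linear_combination e * ξ (g'.right⁻¹ * (g.right⁻¹ * p.1), p.2)
  · refine EllTwo.clm_ext fun ξ p => ?_
    rw [unitaryOp_apply]
    simp [unitaryWeight, h1, EtaleGroupoid.TwoCocycle.one_left h1]

/-- The C*-algebra of the action groupoid of the dual action. -/
abbrev ActionCStar : Type _ := EtaleGroupoid.reducedCStar (restrictCocycle ω (dualAction ω hω))

/-- Left convolution with a function on the slice `{k} × Ĥ`, in the C*-algebra of the action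
groupoid. -/
noncomputable def slice (k : K) (f : C(PontryaginDual H, ℂ)) : ActionCStar ω hω :=
  ⟨sliceOp ω (dualAction ω hω) k f, sliceOp_mem _ _ k f⟩

theorem unitaryOp_mem (g : H ⋊[β] K) :
    unitaryOp ω hω g ∈ EtaleGroupoid.reducedCStar (restrictCocycle ω (dualAction ω hω)) := by
  rw [unitaryOp_eq_smul_sliceOp]
  exact SMulMemClass.smul_mem _ (sliceOp_mem _ _ _ _)

/-- The unitary that corresponds to the point mass at `g`, in the C*-algebra of the action
groupoid. -/
noncomputable def canonicalUnitary (g : H ⋊[β] K) : ActionCStar ω hω :=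
  ⟨unitaryOp ω hω g, unitaryOp_mem ω hω g⟩

theorem isTwistedRep_canonicalUnitary : IsTwistedRep ω.toFun (canonicalUnitary ω hω) where
  mul_eq g h := Subtype.ext ((isTwistedRep_unitaryOp ω hω).mul_eq g h)
  star_eq g := Subtype.ext ((isTwistedRep_unitaryOp ω hω).star_eq g)

theorem sliceOp_evalDual_mem_span (k : K) (h : H) :
    sliceOp ω (dualAction ω hω) k (evalDual h) ∈ (isTwistedRep_unitaryOp ω hω).span := by
  have e := unitaryOp_eq_smul_sliceOp ω hω (inr k * inl h)
  have h1 : (inr k * inl h : H ⋊[β] K).right = k := by simp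
  have h2 : β k⁻¹ (inr k * inl h : H ⋊[β] K).left = h := by simp
  rw [h1, h2] at e
  have e' : sliceOp ω (dualAction ω hω) k (evalDual h) =
      (ω.toFun (inr k) (inl h) : ℂ) • unitaryOp ω hω (inr k * inl h) := by
    rw [e, smul_smul, ← Circle.coe_mul, mul_inv_cancel, Circle.coe_one, one_smul]
  rw [e']
  exact SMulMemClass.smul_mem _ ((isTwistedRep_unitaryOp ω hω).mem_span _)

theorem sliceOp_mem_closure_span (k : K) (f : C(PontryaginDual H, ℂ)) :
    sliceOp ω (dualAction ω hω) k f ∈ (isTwistedRep_unitaryOp ω hω).span.topologicalClosure := by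
  have hle : Submodule.span ℂ (Set.range (evalDual (H := H))) ≤
      ((isTwistedRep_unitaryOp ω hω).span.toSubmodule).comap
        (sliceCLM ω (dualAction ω hω) k).toLinearMap := by
    refine Submodule.span_le.2 ?_
    rintro _ ⟨h, rfl⟩
    exact sliceOp_evalDual_mem_span ω hω k h
  exact map_mem_closure (sliceCLM ω (dualAction ω hω) k).continuous (dense_span_evalDual f) hle

theorem dense_span_canonicalUnitary :
    Dense (Submodule.span ℂ (Set.range (canonicalUnitary ω hω)) : Set (ActionCStar ω hω)) := by
  refine NonUnitalStarSubalgebra.dense_span_of_le _ _ ?_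
  refine NonUnitalStarSubalgebra.topologicalClosure_minimal _
    (t := (isTwistedRep_unitaryOp ω hω).span.topologicalClosure)
    (NonUnitalStarAlgebra.adjoin_le ?_) (NonUnitalStarSubalgebra.isClosed_topologicalClosure _)
  rintro T ⟨φ, hT⟩
  obtain ⟨F, f, rfl⟩ := exists_eq_sum_sliceOp ω (dualAction ω hω) φ hT
  exact sum_mem fun k _ => sliceOp_mem_closure_span ω hω k (f k)

theorem diagCoeff_unitaryOp [DecidableEq K] (g : H ⋊[β] K) (p : K × PontryaginDual H) :
    diagCoeff p (unitaryOp ω hω g) =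
      if g.right = 1 then (dualAction ω hω p.1 p.2 g.left : ℂ) else 0 := by
  classical
  have h1 := toFun_one_one ω hω
  rw [unitaryOp, diagCoeff_weightedShift]
  by_cases hg : g.right = 1
  · simp [hg, unitaryWeight, EtaleGroupoid.TwoCocycle.one_left h1]
  · have : ¬ g.right⁻¹ * p.1 = p.1 := by simpa using hg
    rw [if_neg hg, if_neg]
    exact fun h => this (congrArg Prod.fst h)

theorem diagCoeff_sliceOp_one (f : C(PontryaginDual H, ℂ)) (x : PontryaginDual H) :
    diagCoeff (1, x) (sliceOp ω (dualAction ω hω) 1 f) = f x := by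
  classical
  rw [sliceOp, diagCoeff_weightedShift]
  simp [toFun_one_one ω hω]

theorem continuous_diagCoeff (a : ActionCStar ω hω) :
    Continuous fun x : PontryaginDual H => diagCoeff ((1 : K), x) a.1 := by
  classical
  let S : Submodule ℂ (ActionCStar ω hω) :=
    { carrier := {a | Continuous fun x : PontryaginDual H => diagCoeff ((1 : K), x) a.1}
      add_mem' := fun {a b} (ha : Continuous _) (hb : Continuous _) =>
        (ha.add hb).congr fun x => (map_add (diagCoeff _) a.1 b.1).symm
      zero_mem' := continuous_const.congr fun x => (map_zero (diagCoeff _)).symm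
      smul_mem' := fun c a (ha : Continuous _) =>
        (continuous_const.mul ha).congr fun x => (map_smul (diagCoeff _) c a.1).symm }
  have hS : Submodule.span ℂ (Set.range (canonicalUnitary ω hω)) ≤ S := by
    refine Submodule.span_le.2 ?_
    rintro _ ⟨g, rfl⟩
    change Continuous fun x : PontryaginDual H => diagCoeff ((1 : K), x) (unitaryOp ω hω g)
    simp only [diagCoeff_unitaryOp, map_one, Homeomorph.one_apply]
    by_cases hg : g.right = 1
    · simp only [hg, if_true]
      exact (evalDual g.left).continuous
    · simpa only [hg, if_false] using continuous_const
  -- A uniform limit of continuous functions is continuous.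
  refine continuous_of_uniform_approx_of_continuous fun u hu => ?_
  obtain ⟨ε, hε, hεu⟩ := Metric.mem_uniformity_dist.1 hu
  obtain ⟨b, hb, hab⟩ := Metric.mem_closure_iff.1 (dense_span_canonicalUnitary ω hω a) ε hε
  refine ⟨_, hS hb, fun x => hεu ?_⟩
  rw [dist_eq_norm, ← map_sub]
  refine (norm_diagCoeff_apply_le _ _).trans_lt ?_
  rwa [dist_eq_norm] at hab

/-- The conditional expectation of the C*-algebra of the action groupoid onto `C(Ĥ)`. It restricts a
function on the groupoid to the unit space. -/
noncomputable def dualExp : ActionCStar ω hω →L[ℂ] C(PontryaginDual H, ℂ) :=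
  LinearMap.mkContinuous
    { toFun := fun a => ⟨_, continuous_diagCoeff ω hω a⟩
      map_add' := fun a b => by ext x; exact map_add (diagCoeff _) _ _
      map_smul' := fun c a => by ext x; exact map_smul (diagCoeff _) c a.1 } 1 fun a => by
    rw [one_mul]
    exact (ContinuousMap.norm_le _ (norm_nonneg a)).2 fun x => norm_diagCoeff_apply_le _ _

theorem dualExp_apply (a : ActionCStar ω hω) (x : PontryaginDual H) :
    dualExp ω hω a x = diagCoeff ((1 : K), x) a.1 := rfl

theorem norm_dualExp_le (a : ActionCStar ω hω) : ‖dualExp ω hω a‖ ≤ ‖a‖ :=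
  (ContinuousMap.norm_le _ (norm_nonneg a)).2 fun _ => norm_diagCoeff_apply_le _ _

/-- The diagonal coefficient at an arrow depends only on the range of the arrow. -/
theorem diagCoeff_eq_dualExp (a : ActionCStar ω hω) (p : K × PontryaginDual H) :
    diagCoeff p a.1 = dualExp ω hω a (dualAction ω hω p.1 p.2) := by
  classical
  have : diagCoeff p ∘L (EtaleGroupoid.reducedCStar
      (restrictCocycle ω (dualAction ω hω))).toSubmodule.subtypeL =
      diagCoeff (1, dualAction ω hω p.1 p.2) ∘L (EtaleGroupoid.reducedCStar
        (restrictCocycle ω (dualAction ω hω))).toSubmodule.subtypeL := by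
    refine ContinuousLinearMap.ext_on (dense_span_canonicalUnitary ω hω) ?_
    rintro _ ⟨g, rfl⟩
    change diagCoeff p (unitaryOp ω hω g) = diagCoeff _ (unitaryOp ω hω g)
    rw [diagCoeff_unitaryOp, diagCoeff_unitaryOp, map_one]
    rfl
  exact DFunLike.congr_fun this a

theorem eq_zero_of_dualExp (a : ActionCStar ω hω) (ha : dualExp ω hω (star a * a) = 0) : a = 0 :=
  Subtype.ext (eq_zero_of_diagCoeff_star_mul_self fun p =>
    (diagCoeff_eq_dualExp ω hω (star a * a) p).trans (by rw [ha]; rfl))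

theorem exists_dualExp_star_mul_self (a : ActionCStar ω hω) :
    ∃ f : C(PontryaginDual H, ℂ), dualExp ω hω (star a * a) = star f * f := by
  refine ⟨⟨fun x => ((√(dualExp ω hω (star a * a) x).re : ℝ) : ℂ), by fun_prop⟩, ?_⟩
  ext x
  obtain ⟨r, hr, h⟩ : ∃ r : ℝ, 0 ≤ r ∧ dualExp ω hω (star a * a) x = ((r ^ 2 : ℝ) : ℂ) :=
    ⟨_, norm_nonneg _, diagCoeff_star_mul_self _ _⟩
  change _ = star ((√(dualExp ω hω (star a * a) x).re : ℝ) : ℂ) *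
    ((√(dualExp ω hω (star a * a) x).re : ℝ) : ℂ)
  rw [h, Complex.ofReal_re, Real.sqrt_sq hr, ← starRingEnd_apply, Complex.conj_ofReal,
    ← Complex.ofReal_mul, sq]

/-- The inclusion of `C(Ĥ)` into the C*-algebra of the action groupoid, as functions on the unit
space. -/
noncomputable def unitInclusion : C(PontryaginDual H, ℂ) →⋆ₙₐ[ℂ] ActionCStar ω hω where
  toFun := slice ω hω 1
  map_zero' := Subtype.ext (map_zero (sliceCLM ω (dualAction ω hω) 1))
  map_add' f g := Subtype.ext (map_add (sliceCLM ω (dualAction ω hω) 1) f g)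
  map_smul' c f := Subtype.ext (map_smul (sliceCLM ω (dualAction ω hω) 1) c f)
  map_mul' f g := Subtype.ext <| EllTwo.clm_ext fun ξ p => by
    change sliceOp _ _ _ _ ξ p = sliceOp _ _ _ _ (sliceOp _ _ _ _ ξ) p
    simp [sliceOp_apply, EtaleGroupoid.TwoCocycle.one_left (toFun_one_one ω hω), mul_assoc]
  map_star' f := Subtype.ext <| by
    refine (ContinuousLinearMap.eq_adjoint_iff _ _).2 fun ξ η => ?_
    rw [lp.inner_eq_tsum, lp.inner_eq_tsum]
    refine tsum_congr fun p => ?_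
    change inner ℂ (sliceOp _ _ _ _ ξ p) (η p) = inner ℂ (ξ p) (sliceOp _ _ _ _ η p)
    simp only [sliceOp_apply, inv_one, one_mul, map_one,
      EtaleGroupoid.TwoCocycle.one_left (toFun_one_one ω hω), Circle.coe_one, mul_one,
      RCLike.inner_apply, map_mul, ContinuousMap.star_apply]
    rw [← starRingEnd_apply, Complex.conj_conj]
    ring

theorem dualExp_unitInclusion (f : C(PontryaginDual H, ℂ)) :
    dualExp ω hω (unitInclusion ω hω f) = f :=
  ContinuousMap.ext fun x => diagCoeff_sliceOp_one ω hω f x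

theorem dualExp_unitInclusion_mul (f : C(PontryaginDual H, ℂ)) (a : ActionCStar ω hω) :
    dualExp ω hω (unitInclusion ω hω f * a) = f * dualExp ω hω a := by
  classical
  ext x
  change diagCoeff _ (sliceOp ω (dualAction ω hω) 1 f * a.1) = f x * diagCoeff _ a.1
  rw [diagCoeff_apply, diagCoeff_apply, mul_apply_eq_comp, sliceOp_apply]
  simp [toFun_one_one ω hω]

theorem dualExp_mul_unitInclusion (f : C(PontryaginDual H, ℂ)) (a : ActionCStar ω hω) :
    dualExp ω hω (a * unitInclusion ω hω f) = dualExp ω hω a * f := by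
  classical
  ext x
  change diagCoeff _ (a.1 * sliceOp ω (dualAction ω hω) 1 f) = diagCoeff _ a.1 * f x
  have h : sliceOp ω (dualAction ω hω) 1 f (lp.single 2 ((1 : K), x) 1) =
      f x • lp.single 2 ((1 : K), x) (1 : ℂ) := by
    refine lp.ext (funext fun p => ?_)
    rw [sliceOp_apply, lp.coeFn_smul, Pi.smul_apply, lp.single_apply, lp.single_apply,
      Pi.single_apply, Pi.single_apply]
    by_cases hp : p = (1, x)
    · subst hp
      simp [toFun_one_one ω hω]
    · have hp' : ((1 : K)⁻¹ * p.1, p.2) ≠ (1, x) := by simpa using hp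
      rw [if_neg hp, if_neg hp', mul_zero, smul_zero]
  rw [diagCoeff_apply, diagCoeff_apply, mul_apply_eq_comp]
  rw [h, map_smul, lp.coeFn_smul, Pi.smul_apply, smul_eq_mul, mul_comm]

theorem unitInclusion_evalDual (h : H) :
    unitInclusion ω hω (evalDual h) = canonicalUnitary ω hω (inl h) := by
  refine Subtype.ext (Eq.symm ((unitaryOp_eq_smul_sliceOp ω hω _).trans ?_))
  have h1 : ω.toFun 1 (inl h) = 1 :=
    EtaleGroupoid.TwoCocycle.one_left (toFun_one_one ω hω) _
  simp only [right_inl, left_inl, inv_one, map_one, MulAut.one_apply, h1, Circle.coe_one,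
    one_smul]
  rfl

end CanonicalUnitaries

/-! ### Gradings and `Γ`-Cartan subalgebras from twisted representations -/

/-- A commutative unital C*-algebra is Cartan in itself. -/
theorem IsCartanSubalgebra.of_forall_mem {A : Type*} [NonUnitalCStarAlgebra A]
    (D : NonUnitalStarSubalgebra ℂ A) (hD : ∀ a, a ∈ D) (hcomm : ∀ a b : A, a * b = b * a) (e : A)
    (he : ∀ a, e * a = a) (he1 : ‖e‖ ≤ 1) : IsCartanSubalgebra D where
  isClosed := by
    convert! isClosed_univ
    exact Set.eq_univ_of_forall hD
  maximal := ⟨fun a _ b _ => hcomm a b, fun _ _ _ a _ => hD a⟩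
  exists_condExp :=
    ⟨{ toFun := fun a => ⟨a, hD a⟩, map_add' := fun _ _ => rfl, map_smul' := fun _ _ => rfl },
      { apply_coe := fun _ => rfl
        norm_le := fun _ => le_rfl
        map_mul_left := fun _ _ => rfl
        map_mul_right := fun _ _ => rfl
        positive := fun a => ⟨⟨a, hD a⟩, rfl⟩
        faithful := fun a ha =>
          (CStarRing.star_mul_self_eq_zero_iff a).1 (congrArg Subtype.val ha) }⟩
  generated := by
    convert! dense_univ
    exact Set.eq_univ_of_forall fun a =>
      NonUnitalStarAlgebra.subset_adjoin ℂ _ fun b _ => ⟨hD _, hD _⟩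
  approxUnit := by
    have hse : star e * e = e := by
      rw [← star_inj, star_mul, star_star, hcomm, he]
    refine ⟨fun _ => e, fun _ => ⟨e, hD e, hse.symm⟩, fun _ => he1, fun a => ?_⟩
    simp only [hcomm a e, he]
    exact ⟨tendsto_const_nhds, tendsto_const_nhds⟩

section Components

variable {G Γ A : Type*} [Group G] [CommGroup Γ] [NonUnitalCStarAlgebra A] {w : G → G → Circle}
  {v : G → A}

/-- The closed span of the elements `v g` of a twisted representation with `c g = t`. -/
def twistedComponent (v : G → A) (c : G →* Γ) (t : Γ) : Submodule ℂ A :=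
  (Submodule.span ℂ (v '' {g | c g = t})).topologicalClosure

theorem mem_twistedComponent (v : G → A) (c : G →* Γ) (g : G) :
    v g ∈ twistedComponent v c (c g) :=
  Submodule.le_topologicalClosure _ (Submodule.subset_span ⟨g, rfl, rfl⟩)

variable {c : G →* Γ} {τ : A →L[ℂ] ℂ}

/-- The Fourier coefficients of an element of the component at `t` vanish off the fibre of `t`. -/
theorem IsTwistedRep.apply_star_mul_eq_zero (hv : IsTwistedRep w v)
    (hτ : ∀ g, g ≠ 1 → τ (v g) = 0) {t : Γ} {a : A} (ha : a ∈ twistedComponent v c t) {g : G}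
    (hg : c g ≠ t) : τ (star (v g) * a) = 0 := by
  let F : A →L[ℂ] ℂ := τ ∘L ContinuousLinearMap.mul ℂ A (star (v g))
  refine Submodule.topologicalClosure_minimal _ (t := F.ker) (Submodule.span_le.2 ?_)
    F.isClosed_ker ha
  rintro _ ⟨k, hk, rfl⟩
  change τ (star (v g) * v k) = 0
  have hne : g⁻¹ * k ≠ 1 := by
    rw [Ne, inv_mul_eq_one]
    rintro rfl
    exact hg hk
  rw [hv.star_eq, smul_mul_assoc, hv.mul_eq, map_smul, map_smul, hτ _ hne, smul_zero, smul_zero]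

theorem IsTwistedRep.eq_zero_of_apply_star_mul (hv : IsTwistedRep w v)
    (hd : Dense (Submodule.span ℂ (Set.range v) : Set A)) (hf : ∀ a, τ (star a * a) = 0 → a = 0)
    {a : A} (ha : ∀ g, τ (star (v g) * a) = 0) : a = 0 := by
  refine hf a ?_
  let F : A →L[ℂ] ℂ := τ ∘L (ContinuousLinearMap.mul ℂ A).flip a
  have hF : F = 0 := by
    refine ContinuousLinearMap.ext_on hd ?_
    rintro _ ⟨g, rfl⟩
    have h : v g = ((w g g⁻¹ : Circle) : ℂ) • star (v g⁻¹) := by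
      rw [hv.star_eq, smul_smul, inv_inv, ← Circle.coe_mul, mul_inv_cancel, Circle.coe_one,
        one_smul]
    rw [h, map_smul]
    change _ • τ (star (v g⁻¹) * a) = 0
    rw [ha, smul_zero]
  exact DFunLike.congr_fun hF (star a)

/-- Independence of the components follows from the Fourier coefficients with respect to the
faithful functional `τ`. -/
theorem IsTwistedRep.isStarGrading (hv : IsTwistedRep w v)
    (hd : Dense (Submodule.span ℂ (Set.range v) : Set A)) (hτ : ∀ g, g ≠ 1 → τ (v g) = 0)
    (hf : ∀ a, τ (star a * a) = 0 → a = 0) : IsStarGrading (twistedComponent v c) where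
  isClosed t := Submodule.isClosed_topologicalClosure _
  independent := by
    intro t
    rw [Submodule.disjoint_def]
    intro a ha ha'
    refine hv.eq_zero_of_apply_star_mul hd hf fun g => ?_
    by_cases hg : c g = t
    · let F : A →L[ℂ] ℂ := τ ∘L ContinuousLinearMap.mul ℂ A (star (v g))
      have hle : ⨆ j, ⨆ (_ : j ≠ t), twistedComponent v c j ≤ F.ker :=
        iSup₂_le fun j hj b hb => hv.apply_star_mul_eq_zero hτ hb fun h => hj (h ▸ hg)
      exact hle ha'
    · exact hv.apply_star_mul_eq_zero hτ ha hg
  mul_mem s t a ha b hb := by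
    refine map_mem_closure₂ continuous_mul ha hb fun a ha b hb => ?_
    induction ha, hb using Submodule.span_induction₂ with
    | mem_mem x y hx hy =>
      obtain ⟨g, rfl, rfl⟩ := hx
      obtain ⟨h, rfl, rfl⟩ := hy
      rw [hv.mul_eq]
      exact Submodule.smul_mem _ _ (Submodule.subset_span ⟨_, map_mul c g h, rfl⟩)
    | zero_left y hy => simp
    | zero_right x hx => simp
    | add_left x y z _ _ _ h₁ h₂ => rw [add_mul]; exact add_mem h₁ h₂
    | add_right x y z _ _ _ h₁ h₂ => rw [mul_add]; exact add_mem h₁ h₂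
    | smul_left r x y _ _ h => rw [smul_mul_assoc]; exact Submodule.smul_mem _ _ h
    | smul_right r x y _ _ h => rw [mul_smul_comm]; exact Submodule.smul_mem _ _ h
  star_mem_iff := by
    have key : ∀ (t : Γ), ∀ a ∈ twistedComponent v c t, star a ∈ twistedComponent v c t⁻¹ := by
      intro t a ha
      refine map_mem_closure continuous_star ha fun a ha => ?_
      induction ha using Submodule.span_induction with
      | mem x hx =>
        obtain ⟨g, rfl, rfl⟩ := hx
        rw [hv.star_eq]
        exact Submodule.smul_mem _ _ (Submodule.subset_span ⟨_, map_inv c g, rfl⟩)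
      | zero => simp
      | add x y _ _ h₁ h₂ => rw [star_add]; exact add_mem h₁ h₂
      | smul r x _ h => rw [star_smul]; exact Submodule.smul_mem _ _ h
    exact fun t a => ⟨fun h => by simpa using key t _ h, fun h => by simpa using key _ _ h⟩
  dense := by
    refine hd.mono (Submodule.span_le.2 ?_)
    rintro _ ⟨g, rfl⟩
    exact Submodule.mem_iSup_of_mem (c g) (mem_twistedComponent v c g)

variable {C I : Type*} [CommCStarAlgebra C] {e : I → C} {ι : C →⋆ₙₐ[ℂ] A}

/-- If `ι` maps a family with dense span onto the elements `v g` with `c g = 1`, then its range is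
the neutral component. -/
theorem mem_range_iff_mem_twistedComponent_one (hinj : Function.Injective ι)
    (he : Dense (Submodule.span ℂ (Set.range e) : Set C))
    (hι : Set.range (ι ∘ e) = v '' {g | c g = 1}) (a : A) :
    a ∈ NonUnitalStarAlgHom.range ι ↔ a ∈ twistedComponent v c 1 := by
  have hiso := NonUnitalStarAlgHom.isometry ι hinj
  let L : C →ₗ[ℂ] A := { toFun := ι, map_add' := map_add ι, map_smul' := map_smul ι }
  constructor
  · rintro ⟨f, rfl⟩
    refine map_mem_closure hiso.continuous (he f) ?_
    have hle : Submodule.span ℂ (Set.range e) ≤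
        (Submodule.span ℂ (v '' {g | c g = 1})).comap L := by
      refine Submodule.span_le.2 ?_
      rintro _ ⟨h, rfl⟩
      exact Submodule.subset_span (hι ▸ ⟨h, rfl⟩)
    exact hle
  · intro ha
    have hc : IsClosed (Set.range ι) := hiso.isClosedEmbedding.isClosed_range
    refine Submodule.topologicalClosure_minimal _ (t := L.range) (Submodule.span_le.2 ?_) hc ha
    rw [← hι]
    rintro _ ⟨h, rfl⟩
    exact ⟨e h, rfl⟩

/-- If the neutral component is the image of a commutative algebra under `ι`, and `ι ∘ E` is a
faithful conditional expectation onto it, then the grading is topological and the neutral component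
is itself a `Γ`-Cartan subalgebra. -/
theorem IsTwistedRep.isGammaCartan_range [Nontrivial C] (hv : IsTwistedRep w v)
    (hd : Dense (Submodule.span ℂ (Set.range v) : Set A)) (hτ : ∀ g, g ≠ 1 → τ (v g) = 0)
    (hτf : ∀ a, τ (star a * a) = 0 → a = 0)
    (he : Dense (Submodule.span ℂ (Set.range e) : Set C))
    (hι : Set.range (ι ∘ e) = v '' {g | c g = 1}) (E : A →ₗ[ℂ] C)
    (hEι : ∀ f, E (ι f) = f) (hE : ∀ a, ‖E a‖ ≤ ‖a‖)
    (hl : ∀ f a, E (ι f * a) = f * E a) (hr : ∀ f a, E (a * ι f) = E a * f)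
    (hp : ∀ a, ∃ f, E (star a * a) = star f * f) (hf : ∀ a, E (star a * a) = 0 → a = 0) :
    IsGammaCartan (twistedComponent v c) (NonUnitalStarAlgHom.range ι) := by
  have hinj : Function.Injective ι := Function.LeftInverse.injective hEι
  have hiso := NonUnitalStarAlgHom.isometry ι hinj
  have hnorm := NonUnitalStarAlgHom.norm_map ι hinj
  have hmem := mem_range_iff_mem_twistedComponent_one hinj he hι
  have hg := hv.isStarGrading (c := c) hd hτ hτf
  have hcomm : ∀ a ∈ NonUnitalStarAlgHom.range ι, ∀ b ∈ NonUnitalStarAlgHom.range ι,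
      a * b = b * a := by
    rintro _ ⟨f, rfl⟩ _ ⟨f', rfl⟩
    exact (map_mul ι f f').symm.trans ((congrArg ι (mul_comm f f')).trans (map_mul ι f' f))
  have htop : IsTopologicalGrading (twistedComponent v c) := by
    refine ⟨hg, ?_⟩
    have hn (f : C) : ι f ∈ hg.neutral := (hmem _).1 ⟨f, rfl⟩
    have hn' (b : hg.neutral) : ∃ f, ι f = b := (hmem _).2 b.2
    refine ⟨{ toFun := fun a => ⟨ι (E a), hn _⟩
              map_add' := fun a b => Subtype.ext (by simp)
              map_smul' := fun c a => Subtype.ext (by simp) }, ?_⟩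
    constructor
    · intro b
      obtain ⟨f, hb⟩ := hn' b
      refine Subtype.ext ?_
      change ι (E b) = b
      rw [← hb, hEι]
    · exact fun a => (hnorm _).trans_le (hE a)
    · intro b a
      obtain ⟨f, hb⟩ := hn' b
      refine Subtype.ext ?_
      change ι (E (b * a)) = b * ι (E a)
      rw [← hb, hl, map_mul]
    · intro a b
      obtain ⟨f, hb⟩ := hn' b
      refine Subtype.ext ?_
      change ι (E (a * b)) = ι (E a) * b
      rw [← hb, hr, map_mul]
    · intro a
      obtain ⟨f, hf⟩ := hp a
      refine ⟨⟨ι f, hn f⟩, Subtype.ext ?_⟩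
      change ι (E (star a * a)) = star (ι f) * ι f
      rw [hf, map_mul, map_star]
    · intro a ha
      have ha' : ι (E (star a * a)) = 0 := congrArg Subtype.val ha
      exact hf a ((map_eq_zero_iff ι hinj).1 ha')
  refine ⟨htop, ?_, hcomm, fun a ha => (hmem a).1 ha, ?_, ?_⟩
  · exact hiso.isClosedEmbedding.isClosed_range
  · have hcl : IsClosed (htop.toIsStarGrading.neutral : Set (A)) :=
      htop.isClosed 1
    have hn' (b : htop.toIsStarGrading.neutral) : ∃ f, ι f = b := (hmem _).2 b.2
    refine IsCartanSubalgebra.of_forall_mem _ (fun a => (hmem _).2 a.2)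
      (fun a b => Subtype.ext (hcomm _ ((hmem _).2 a.2) _ ((hmem _).2 b.2)))
      ⟨ι 1, (hmem _).1 ⟨1, rfl⟩⟩ (fun a => ?_) ?_
    · obtain ⟨f, ha⟩ := hn' a
      refine Subtype.ext ?_
      change ι 1 * (a : A) = a
      rw [← ha, ← map_mul, one_mul]
    · exact (hnorm 1).trans_le norm_one.le
  · -- Each point mass normalizes the neutral component, because the grading group is commutative.
    refine (hd).mono (Submodule.span_mono ?_)
    rintro _ ⟨g, rfl⟩
    have hv := mem_twistedComponent v c g
    have hs := (hg.star_mem_iff _ (star (v g))).1 (by rwa [star_star])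
    intro b hb
    rw [hmem] at hb
    rw [hmem, hmem]
    constructor
    · simpa using hg.mul_mem _ _ _ (hg.mul_mem _ _ _ hs _ hb) _ hv
    · simpa using hg.mul_mem _ _ _ (hg.mul_mem _ _ _ hv _ hb) _ hs

/-- The conditional expectation and the inclusion of `C` that make the grading `Γ`-Cartan may be
given on an isomorphic copy `B` of `A`. -/
theorem IsTwistedRep.exists_isGammaCartan_range [Nontrivial C] {B : Type*}
    [NonUnitalCStarAlgebra B] (hv : IsTwistedRep w v)
    (hd : Dense (Submodule.span ℂ (Set.range v) : Set A)) (hτ : ∀ g, g ≠ 1 → τ (v g) = 0)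
    (hτf : ∀ a, τ (star a * a) = 0 → a = 0)
    (he : Dense (Submodule.span ℂ (Set.range e) : Set C)) {s : I → G}
    (hs : Set.range s = {g | c g = 1}) (Φ : A ≃⋆ₐ[ℂ] B) (j : C →⋆ₙₐ[ℂ] B)
    (hj : ∀ i, j (e i) = Φ (v (s i))) (E : B →L[ℂ] C)
    (hEj : ∀ f, E (j f) = f) (hE : ∀ b, ‖E b‖ ≤ ‖b‖)
    (hl : ∀ f b, E (j f * b) = f * E b) (hr : ∀ f b, E (b * j f) = E b * f)
    (hp : ∀ b, ∃ f, E (star b * b) = star f * f) (hf : ∀ b, E (star b * b) = 0 → b = 0) :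
    ∃ ι : C →⋆ₙₐ[ℂ] A, Function.Injective ι ∧ (∀ i, ι (e i) = v (s i)) ∧
      IsGammaCartan (twistedComponent v c) (NonUnitalStarAlgHom.range ι) := by
  have hinj : Function.Injective Φ := EquivLike.injective Φ
  let ι : C →⋆ₙₐ[ℂ] A := (Φ.symm : B →⋆ₙₐ[ℂ] A).comp j
  have hΦι (f) : Φ (ι f) = j f := Φ.apply_symm_apply _
  have hι (i) : ι (e i) = v (s i) := hinj (by rw [hΦι, hj])
  let F : A →ₗ[ℂ] C :=
    { toFun := fun a => E (Φ a)
      map_add' := fun a b => by rw [map_add, map_add]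
      map_smul' := fun r a => by rw [map_smul, map_smul, RingHom.id_apply] }
  have hF (a) : F a = E (Φ a) := rfl
  have hFι (f) : F (ι f) = f := by rw [hF, hΦι, hEj]
  refine ⟨ι, Function.LeftInverse.injective hFι, hι, ?_⟩
  refine hv.isGammaCartan_range hd hτ hτf he ?_ F hFι (fun a => ?_) (fun f a => ?_)
    (fun f a => ?_) (fun a => ?_) fun a ha => ?_
  · rw [show ι ∘ e = v ∘ s from funext hι, Set.range_comp, hs]
  · exact (hE _).trans_eq (NonUnitalStarAlgHom.norm_map Φ hinj a)
  · rw [hF, hF, map_mul, hΦι, hl]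
  · rw [hF, hF, map_mul, hΦι, hr]
  · rw [hF, map_mul, map_star]
    exact hp _
  · rw [hF, map_mul, map_star] at ha
    exact (map_eq_zero_iff Φ hinj).1 (hf _ ha)

end Components

/-! ### The comparison of the two C*-algebras -/

section GroupGrading

open SemidirectProduct

variable {H K : Type*} [CommGroup H] [CommGroup K] [TopologicalSpace H] [TopologicalSpace K]
  [DiscreteTopology H] [DiscreteTopology K] {β : K →* MulAut H}
  {ω : (groupGroupoid (H ⋊[β] K)).TwoCocycle}

set_option maxHeartbeats 4000000 in
set_option synthInstance.maxHeartbeats 400000 in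
/-- For a discrete group, the functions that span a component are combinations of point masses. -/
theorem gradedPart_eq : EtaleGroupoid.gradedPart ω (fun g : H ⋊[β] K => g.right) =
    twistedComponent (pointMass ω) SemidirectProduct.rightHom := by
  refine funext fun t => congrArg Submodule.topologicalClosure (le_antisymm ?_ ?_)
  · refine Submodule.span_le.2 ?_
    rintro a ⟨φ, hφ, ha⟩
    have h : a = ∑ g ∈ φ.finite_support_of_discrete.toFinset, φ g • pointMass ω g := by
      refine Subtype.ext ((ha.eq_sum_pointMassOp ω φ.finite_support_of_discrete.toFinset
        fun g hg => by simpa using hg).trans ?_)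
      exact (map_sum (EtaleGroupoid.reducedCStar ω).toSubmodule.subtype
        (fun g => φ g • pointMass ω g) _).symm
    rw [h]
    exact sum_mem fun g hg => Submodule.smul_mem _ _
      (Submodule.subset_span ⟨g, hφ g (by simpa using hg), rfl⟩)
  · refine Submodule.span_mono ?_
    rintro _ ⟨g, hg, rfl⟩
    have hs : HasCompactSupport (Set.indicator {g} (1 : H ⋊[β] K → ℂ)) :=
      HasCompactSupport.intro (K := {g}) isCompact_singleton fun x hx => by simp_all
    refine ⟨⟨⟨Set.indicator {g} 1, continuous_of_discreteTopology⟩, hs⟩, fun k hk => ?_,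
      isLeftConvolution_pointMassOp ω g⟩
    have hk' : k ∈ ({g} : Set (H ⋊[β] K)) := Set.mem_of_indicator_ne_zero hk
    rw [Set.mem_singleton_iff.1 hk']
    exact hg

end GroupGrading

section Comparison

open SemidirectProduct

variable {H K : Type*} [CommGroup H] [CommGroup K] [TopologicalSpace H] [TopologicalSpace K]
  [DiscreteTopology H] [DiscreteTopology K] {β : K →* MulAut H}
  (ω : (groupGroupoid (H ⋊[β] K)).TwoCocycle)
  (hω : ∀ h h' : H, ω.toFun (inl h) (inl h') = 1)

set_option maxHeartbeats 4000000 in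
set_option synthInstance.maxHeartbeats 400000 in
/-- The point masses in the twisted group C*-algebra and the canonical unitaries of the action
groupoid have the same trace, where the trace of the latter is the Haar integral of the conditional
expectation onto `C(Ĥ)`. -/
theorem exists_starAlgEquiv_actionCStar :
    ∃ Φ : EtaleGroupoid.reducedCStar ω ≃⋆ₐ[ℂ] ActionCStar ω hω,
      ∀ g, Φ (pointMass ω g) = canonicalUnitary ω hω g := by
  classical
  have h1 := toFun_one_one ω hω
  obtain ⟨σ, hσ, hσf⟩ := exists_haarFunctional (H := H)
  refine (isTwistedRep_pointMass h1).exists_starAlgEquiv (isTwistedRep_canonicalUnitary ω hω)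
    (dense_span_pointMass h1) (dense_span_canonicalUnitary ω hω) (groupTrace ω)
    (σ ∘L dualExp ω hω) (fun g => ?_) (eq_zero_of_groupTrace h1) fun b hb => ?_
  · rw [groupTrace_pointMass h1, ContinuousLinearMap.comp_apply]
    have he : dualExp ω hω (canonicalUnitary ω hω g) =
        if g.right = 1 then evalDual g.left else 0 := by
      ext x
      rw [dualExp_apply]
      refine (diagCoeff_unitaryOp ω hω g _).trans ?_
      split_ifs
      · rw [map_one]; rfl
      · rfl
    rw [he]
    by_cases hr : g.right = 1
    · rw [if_pos hr, hσ]
      refine if_congr ?_ rfl rfl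
      rw [SemidirectProduct.ext_iff]
      simp [hr]
    · rw [if_neg hr, map_zero, if_neg fun h => hr (congrArg SemidirectProduct.right h)]
  · obtain ⟨f, hf⟩ := exists_dualExp_star_mul_self ω hω b
    refine eq_zero_of_dualExp ω hω b ?_
    rw [ContinuousLinearMap.comp_apply, hf] at hb
    rw [hf, hσf f hb, mul_zero]

end Comparison

set_option maxHeartbeats 4000000 in
set_option synthInstance.maxHeartbeats 400000 in
theorem mainTheorem7 {H K : Type*} [CommGroup H] [CommGroup K]
    [TopologicalSpace H] [TopologicalSpace K] [DiscreteTopology H] [DiscreteTopology K]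
    (β : K →* MulAut H) (ω : (groupGroupoid (H ⋊[β] K)).TwoCocycle)
    (hω : ∀ h h' : H, ω.toFun (SemidirectProduct.inl h) (SemidirectProduct.inl h') = 1) :
    (∃ ι : C(PontryaginDual H, ℂ) →⋆ₙₐ[ℂ] EtaleGroupoid.reducedCStar ω,
      Function.Injective ι ∧
      (∀ h : H, EtaleGroupoid.IsLeftConvolution ω
        (Set.indicator {SemidirectProduct.inl h} (1 : H ⋊[β] K → ℂ)) (ι (evalDual h))) ∧
      IsGammaCartan (EtaleGroupoid.gradedPart ω (fun g : H ⋊[β] K => g.right))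
        (NonUnitalStarAlgHom.range ι)) ∧
    Nonempty (EtaleGroupoid.reducedCStar ω ≃⋆ₐ[ℂ]
      EtaleGroupoid.reducedCStar (restrictCocycle ω (dualAction ω hω))) := by
  classical
  have h1 := toFun_one_one ω hω
  obtain ⟨Φ, hΦ⟩ := exists_starAlgEquiv_actionCStar ω hω
  have hs : Set.range (SemidirectProduct.inl : H →* H ⋊[β] K) =
      {g | SemidirectProduct.rightHom g = 1} := by
    rw [← MonoidHom.coe_range, SemidirectProduct.range_inl_eq_ker_rightHom]
    rfl
  obtain ⟨ι, hinj, hι, hΓ⟩ := (isTwistedRep_pointMass h1).exists_isGammaCartan_range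
    (dense_span_pointMass h1) (fun g hg => by rw [groupTrace_pointMass h1, if_neg hg])
    (eq_zero_of_groupTrace h1) dense_span_evalDual hs Φ (unitInclusion ω hω)
    (fun h => by rw [hΦ, unitInclusion_evalDual]) (dualExp ω hω) (dualExp_unitInclusion ω hω)
    (norm_dualExp_le ω hω) (dualExp_unitInclusion_mul ω hω) (dualExp_mul_unitInclusion ω hω)
    (exists_dualExp_star_mul_self ω hω) (eq_zero_of_dualExp ω hω)
  rw [← gradedPart_eq] at hΓ
  refine ⟨⟨ι, hinj, fun h => ?_, hΓ⟩, ⟨Φ⟩⟩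
  rw [hι]
  exact isLeftConvolution_pointMassOp ω _
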